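/- Let \((X,d_X,\mathfrak m_X)\) and \((Y,d_Y,\mathfrak m_Y)\) be metric measure spaces (complete separable metric spaces with a nonnegative Borel measure that is finite on bounded sets), let \(p\in(1,\infty)\), let \(K\ge 0\) be a real number and let \(\varphi\colon X\to Y\) be continuous. **Notation.** A curve is a continuous map from a compact interval; \(\varphi\Gamma=\{\varphi\circ\gamma:\gamma\in\Gamma\}\). For a family \(\Gamma\) of curves, \(\mathrm{Mod}_p(\Gamma)\) is the infimum of \(\int\rho^p\,d\mathfrak m\) over all Borel \(\rho\) with values in \([0,\infty]\) such that \(\int_\gamma\rho\,ds\ge 1\) for every rectifiable \(\gamma\in\Gamma\). The outer dilatation \(K_O(\varphi)\in[0,\infty]\) is the infimum of the constants \(C\in[0,\infty)\) such that \(\mathrm{Mod}_p(\Gamma)\le C\,\mathrm{Mod}_p(\varphi\Gamma)\) for all families \(\Gamma\) of curves in \(X\). Let \(W\) be a metric measure space, or an open or closed subset of one with the restricted metric and measure, and let \(h\colon W\to Z\) be a map to a metric space. A Borel function \(g\colon W\to[0,\infty]\) is a weak upper gradient of \(h\) if \(d_Z(h(\gamma(a)),h(\gamma(b)))\le\int_\gamma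 g\,ds\) for all rectifiable curves \(\gamma\colon[a,b]\to W\) outside a family of \(p\)-modulus zero. \(\mathrm{UG}^p(h)\) and \(\mathrm{UG}^p_{\rm loc}(h)\) are the sets of weak upper gradients of \(h\) that are \(p\)-integrable and locally \(p\)-integrable, respectively. A minimal weak upper gradient \(\rho_h\) is an element of \(\mathrm{UG}^p_{\rm loc}(h)\) that is at most every other element almost everywhere; it is unique up to null sets. The map \(h\) is measurable if it has separable image off a null set and preimages of open sets are measurable with respect to the completion of the measure. \(D^{1,p}(W,Z)\) and \(D^{1,p}_{\rm loc}(W,Z)\) are the sets of measurable \(h\) with \(\mathrm{UG}^p(h)\ne\emptyset\) and \(\mathrm{UG}^p_{\rm loc}(h)\ne\emptyset\), respectively. Throughout, \(0\cdot\infty=0\). **Proposition.** The following are equivalent. - **(1)** \(K_O(\varphi)\le K\). - **(2)** For every open \(\Omega\subset Y\) with \(\Omega'=\varphi^{-1}(\Omega)\), every metric space \(Z\) and every \(h\in D^{1,p}(\Omega,Z)\), we have \(\mathrm{UG}^p(h\circ\varphi|_{\Omega'})\neq\emptyset\) (so that \(h\circ\varphi|_{\Omega'}\in D^{1,p}(\Omega',Z)\)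 whenever \(h\circ\varphi|_{\Omega'}\) is measurable, which is automatic for instance if \(h\) is continuous, or Borel with separable image), minimal weak upper gradients \(\rho_h\) and \(\rho_{h\circ\varphi|_{\Omega'}}\) exist, and \[\int_{\Omega'}(g\circ\varphi)\,\rho_{h\circ\varphi|_{\Omega'}}^p\,d\mathfrak m_X\le K\int_\Omega g\,\rho_h^p\,d\mathfrak m_Y\] for every \(g\colon\Omega\to[0,\infty]\) such that \(g\rho_h^p\) is Borel with \(\int_\Omega g\rho_h^p\,d\mathfrak m_Y<\infty\). - **(2′)** The properties in (2) hold for every closed set \(\Omega\subset Y\) with \(\mathfrak m_Y(\Omega)<\infty\), in place of open sets. - **(3)** \(\varphi\in D^{1,p}_{\rm loc}(X,Y)\), a minimal weak upper gradient \(\rho_\varphi\) exists, and \(\int_{\varphi^{-1}(E)}\rho_\varphi^p\,d\mathfrak m_X\le K\,\mathfrak m_Y(E)\) for every Borel \(E\subset Y\). -/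

import Mathlib

open Set MeasureTheory
open scoped ENNReal NNReal

universe u v w

namespace MetricSobolev

/-- A measure on a metric space is boundedly finite if bounded sets have finite measure. -/
def IsBoundedlyFinite {X : Type*} [MetricSpace X] [MeasurableSpace X] (μ : Measure X) : Prop :=
  ∀ s : Set X, Bornology.IsBounded s → μ s < ∞

/-- The measure induced by `μ` on a (Borel) subset, as a measure on the subtype. -/
noncomputable def subspaceMeasure {X : Type*} [MeasurableSpace X] (μ : Measure X) (s : Set X) :
    Measure s :=
  μ.comap (Subtype.val : s → X)

/-- A curve: a continuous map from a compact interval `[left, right]`. -/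
structure Curve (X : Type*) [TopologicalSpace X] where
  /-- left end point of the parameter interval -/
  left : ℝ
  /-- right end point of the parameter interval -/
  right : ℝ
  left_le_right : left ≤ right
  /-- the continuous map itself -/
  path : C(Icc left right, X)

namespace Curve

/-- The curve as a function on `ℝ`, extended by its end values outside the parameter interval. -/
noncomputable def extend {X : Type*} [TopologicalSpace X] (γ : Curve X) : ℝ → X :=
  IccExtend γ.left_le_right γ.path

/-- The composition `φ ∘ γ` of a curve with a continuous map. -/
def map {X Y : Type*} [TopologicalSpace X] [TopologicalSpace Y] (φ : C(X, Y)) (γ : Curve X) :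
    Curve Y where
  left := γ.left
  right := γ.right
  left_le_right := γ.left_le_right
  path := φ.comp γ.path

variable {X : Type*} [MetricSpace X]

/-- The length: the supremum of `∑ d(γ(tᵢ₋₁), γ(tᵢ))` over partitions of the interval. -/
noncomputable def length (γ : Curve X) : ℝ≥0∞ :=
  eVariationOn γ.extend (Icc γ.left γ.right)

/-- Curves of finite length. -/
def IsRectifiable (γ : Curve X) : Prop :=
  γ.length ≠ ∞

/-- The unit speed parametrization of a rectifiable curve, on `[0, length]`: it sends `t` to
`γ(s)`, where `s` is a parameter such that the restriction of `γ` to `[left, s]` has length `t`. -/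
noncomputable def unitSpeed (γ : Curve X) : ℝ → X :=
  naturalParameterization γ.extend (Icc γ.left γ.right) γ.left

/-- The path integral `∫_γ ρ ds` of `ρ : X → [0, ∞]` over a rectifiable curve (it is only ever
used for rectifiable curves). -/
noncomputable def integral (γ : Curve X) (ρ : X → ℝ≥0∞) : ℝ≥0∞ :=
  ∫⁻ t in Icc (0 : ℝ) γ.length.toReal, ρ (γ.unitSpeed t)

end Curve

section Modulus

variable {X : Type*} [MetricSpace X] [MeasurableSpace X]

/-- `ρ : X → [0, ∞]` is admissible for `Γ`: it is Borel and `∫_γ ρ ds ≥ 1` for every rectifiable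
`γ ∈ Γ`. -/
def IsAdmissible (Γ : Set (Curve X)) (ρ : X → ℝ≥0∞) : Prop :=
  Measurable ρ ∧ ∀ γ ∈ Γ, γ.IsRectifiable → 1 ≤ γ.integral ρ

/-- The `p`-modulus of a family of curves. -/
noncomputable def modulus (p : ℝ) (μ : Measure X) (Γ : Set (Curve X)) : ℝ≥0∞ :=
  ⨅ (ρ : X → ℝ≥0∞) (_ : IsAdmissible Γ ρ), ∫⁻ x, ρ x ^ p ∂μ

end Modulus

section UpperGradients

variable {X : Type*} [MetricSpace X] [MeasurableSpace X] {Z : Type*} [MetricSpace Z]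

/-- `g : X → [0, ∞]` is a weak upper gradient of `h`: it is Borel and
`d(h(γ(a)), h(γ(b))) ≤ ∫_γ g ds` for all rectifiable curves `γ : [a, b] → X` outside a family of
modulus zero (nonrectifiable curves always form a family of modulus zero). -/
def IsWeakUpperGradient (p : ℝ) (μ : Measure X) (h : X → Z) (g : X → ℝ≥0∞) : Prop :=
  Measurable g ∧ ∃ N : Set (Curve X), modulus p μ N = 0 ∧
    ∀ γ : Curve X, γ ∉ N → γ.IsRectifiable →
      edist (h (γ.extend γ.left)) (h (γ.extend γ.right)) ≤ γ.integral g

/-- The `p`-integrable weak upper gradients of `h`. -/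
def UG (p : ℝ) (μ : Measure X) (h : X → Z) : Set (X → ℝ≥0∞) :=
  {g | IsWeakUpperGradient p μ h g ∧ ∫⁻ x, g x ^ p ∂μ < ∞}

/-- The locally `p`-integrable weak upper gradients of `h`. -/
def UGloc (p : ℝ) (μ : Measure X) (h : X → Z) : Set (X → ℝ≥0∞) :=
  {g | IsWeakUpperGradient p μ h g ∧
    ∀ x : X, ∃ U : Set X, IsOpen U ∧ x ∈ U ∧ ∫⁻ y in U, g y ^ p ∂μ < ∞}

/-- `ρ` is a minimal weak upper gradient of `h`. -/
def IsMinimalUpperGradient (p : ℝ) (μ : Measure X) (h : X → Z) (ρ : X → ℝ≥0∞) : Prop :=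
  ρ ∈ UGloc p μ h ∧ ∀ g ∈ UGloc p μ h, ρ ≤ᵐ[μ] g

/-- Minimal weak upper gradients are unique up to almost everywhere equality. -/
theorem IsMinimalUpperGradient.ae_eq {p : ℝ} {μ : Measure X} {h : X → Z} {ρ ρ' : X → ℝ≥0∞}
    (hρ : IsMinimalUpperGradient p μ h ρ) (hρ' : IsMinimalUpperGradient p μ h ρ') :
    ρ =ᵐ[μ] ρ' :=
  (hρ.2 ρ' hρ'.1).antisymm (hρ'.2 ρ hρ.1)

/-- Measurability of a map from a metric measure space to a metric space: off a null set the
image is separable, and preimages of open sets are `μ`-measurable (that is, measurable for the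
completion of `μ`). -/
def IsMeasurableMap (μ : Measure X) (h : X → Z) : Prop :=
  (∃ N : Set X, μ N = 0 ∧ TopologicalSpace.IsSeparable (h '' Nᶜ)) ∧
    ∀ U : Set Z, IsOpen U → NullMeasurableSet (h ⁻¹' U) μ

/-- The `p`-Dirichlet space `D^{1,p}(X, Z)`. -/
def MemDirichlet (p : ℝ) (μ : Measure X) (h : X → Z) : Prop :=
  IsMeasurableMap μ h ∧ (UG p μ h).Nonempty

/-- The local `p`-Dirichlet space `D^{1,p}_loc(X, Z)`. -/
def MemDirichletLoc (p : ℝ) (μ : Measure X) (h : X → Z) : Prop :=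
  IsMeasurableMap μ h ∧ (UGloc p μ h).Nonempty

end UpperGradients

section Maps

variable {X : Type u} [MetricSpace X] [MeasurableSpace X]
  {Y : Type v} [MetricSpace Y] [MeasurableSpace Y]

/-- The outer dilatation `K_O(φ)`: the infimum of the constants `C ≥ 0` such that
`Mod_p(Γ) ≤ C Mod_p(φ Γ)` for all families of curves `Γ` (infinite if there is none). -/
noncomputable def outerDilatation (p : ℝ) (μ : Measure X) (ν : Measure Y) (φ : C(X, Y)) : ℝ≥0∞ :=
  ⨅ (C : ℝ≥0) (_ : ∀ Γ : Set (Curve X), modulus p μ Γ ≤ C * modulus p ν (Curve.map φ '' Γ)),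
    (C : ℝ≥0∞)

/-- Composition with `φ : φ⁻¹(Ω) → Ω` preserves Dirichlet maps into all metric spaces, with the
weighted energy inequality with constant `K`. The minimal weak upper gradients `ρ` of `h` and
`ρ'` of `h ∘ φ` are unique almost everywhere, so their choice does not matter. The function `h`
need not be Borel and the preimage of a null set need not be a null set, so the measurability of
`h ∘ φ` is not automatic. -/
def PullsBackDirichlet (p : ℝ) (μ : Measure X) (ν : Measure Y) (φ : C(X, Y)) (K : ℝ≥0)
    (Ω : Set Y) : Prop :=
  ∀ (Z : Type w) [MetricSpace Z] (h : Ω → Z), MemDirichlet p (subspaceMeasure ν Ω) h →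
    (UG p (subspaceMeasure μ (φ ⁻¹' Ω)) (h ∘ Ω.restrictPreimage φ)).Nonempty ∧
    (IsMeasurableMap (subspaceMeasure μ (φ ⁻¹' Ω)) (h ∘ Ω.restrictPreimage φ) →
      MemDirichlet p (subspaceMeasure μ (φ ⁻¹' Ω)) (h ∘ Ω.restrictPreimage φ)) ∧
    ∃ (ρ : Ω → ℝ≥0∞) (ρ' : φ ⁻¹' Ω → ℝ≥0∞),
      IsMinimalUpperGradient p (subspaceMeasure ν Ω) h ρ ∧
      IsMinimalUpperGradient p (subspaceMeasure μ (φ ⁻¹' Ω)) (h ∘ Ω.restrictPreimage φ) ρ' ∧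
      ∀ g : Ω → ℝ≥0∞, Measurable (fun y => g y * ρ y ^ p) →
        ∫⁻ y, g y * ρ y ^ p ∂(subspaceMeasure ν Ω) < ∞ →
        ∫⁻ x, g (Ω.restrictPreimage φ x) * ρ' x ^ p ∂(subspaceMeasure μ (φ ⁻¹' Ω)) ≤
          K * ∫⁻ y, g y * ρ y ^ p ∂(subspaceMeasure ν Ω)

end Maps

end MetricSobolev

namespace MetricSobolev

open Filter Topology

/-! All conditions are compared with the existence of a `ρ ∈ UGloc p μ φ` satisfying the energy
bound `∫_{φ⁻¹E} ρ^p dμ ≤ K ν(E)` for Borel `E`; a minimal weak upper gradient exists and inherits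
the bound.

Two translations carry the argument. A family has modulus zero iff one `p`-integrable `τ` has
infinite integral along each of its rectifiable curves (`modulus_eq_zero_iff`). Hence "almost every
curve" means `∫_γ τ < ∞`, which passes to subcurves and survives countably many conditions. Line
integrals are integrals against an atomless arc length measure on the parameter interval, so an
upper gradient inequality on all subcurves says that the arc length measure of the image curve is at
most `g ds`. Such inequalities can be restricted to Borel pieces and glued, which yields minima of
upper gradients and from them minimal ones.

Energy bound to the rest: along almost every `γ`, `∫_{φγ} σ ≤ ∫_γ (σ∘φ)ρ`, and the energy of
`(σ∘φ)ρ` is at most `K` times that of `σ`. Taking `σ` admissible gives the modulus inequality;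
taking `σ = ρ_h` gives an upper gradient of `h∘φ`.

Dilatation to energy bound: for small `δ`, the curves with `∫_{φγ} σ ≥ δ` have modulus at most `K
δ^{-p} ∫σ^p`. A nearly optimal weight times `δ` dominates `σ` along image curves up to an error `δ`,
as seen by cutting each curve into pieces of `σ`-length `δ`. Uniform convexity of `L^p` makes
suitable such weights converge as `δ → 0` (`exists_integral_map_le`). With `σ` the indicator of `E`,
the limit may replace `ρ_φ` on `φ⁻¹E`, so minimality bounds the energy there.

Pull-back to energy bound: apply the hypothesis to an isometric embedding of balls of `Y`, which has
upper gradient `1`, and let the balls exhaust `Y`. -/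

theorem lintegral_iSup_rpow_le_tsum {α ι : Type*} [MeasurableSpace α] [Countable ι]
    (μ : Measure α) {p : ℝ} (hp : 0 < p) (f : ι → α → ℝ≥0∞) (hf : ∀ i, Measurable (f i)) :
    ∫⁻ x, (⨆ i, f i x) ^ p ∂μ ≤ ∑' i, ∫⁻ x, f i x ^ p ∂μ := by
  rw [← lintegral_tsum fun i => ((hf i).pow_const p).aemeasurable]
  refine lintegral_mono fun x => ?_
  have : (⨆ i, f i x) ^ p = ⨆ i, f i x ^ p := (ENNReal.orderIsoRpow p hp).map_iSup _
  simp only [this]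
  exact iSup_le fun i => ENNReal.le_tsum i

/-- Countably many `p`-integrable functions are, up to positive factors, dominated by a single
`p`-integrable function. -/
theorem exists_lintegral_iSup_mul_rpow_ne_top {α ι : Type*} [MeasurableSpace α] [Countable ι]
    (μ : Measure α) {p : ℝ} (hp : 0 < p) (f : ι → α → ℝ≥0∞) (hf : ∀ i, Measurable (f i))
    (h : ∀ i, ∫⁻ x, f i x ^ p ∂μ ≠ ∞) :
    ∃ c : ι → ℝ≥0∞, (∀ i, c i ≠ 0) ∧ (∀ i, c i ≠ ∞) ∧
      ∫⁻ x, (⨆ i, c i * f i x) ^ p ∂μ ≠ ∞ := by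
  obtain ⟨δ, δpos, hδ⟩ := ENNReal.exists_pos_sum_of_countable' (one_ne_zero (α := ℝ≥0∞)) ι
  have hδt : ∀ i, δ i ≠ ∞ := fun i =>
    ((ENNReal.le_tsum i).trans_lt (hδ.trans ENNReal.one_lt_top)).ne
  have h1 : ∀ i, δ i / (∫⁻ x, f i x ^ p ∂μ + 1) ≠ ∞ := fun i =>
    ENNReal.div_ne_top (hδt i) (by simp)
  -- These factors make the energy of `c i * f i` at most `δ i`, and the `δ i` are summable; the `+
  -- 1` avoids division by a vanishing energy.
  refine ⟨fun i => (δ i / (∫⁻ x, f i x ^ p ∂μ + 1)) ^ p⁻¹, fun i => ?_, fun i => ?_, ?_⟩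
  · have : δ i / (∫⁻ x, f i x ^ p ∂μ + 1) ≠ 0 :=
      (ENNReal.div_pos (δpos i).ne' (ENNReal.add_ne_top.2 ⟨h i, ENNReal.one_ne_top⟩)).ne'
    exact (ENNReal.rpow_pos (pos_iff_ne_zero.2 this) (h1 i)).ne'
  · exact ENNReal.rpow_ne_top_of_nonneg (inv_nonneg.2 hp.le) (h1 i)
  · refine ((lintegral_iSup_rpow_le_tsum μ hp _ fun i => (hf i).const_mul _).trans_lt ?_).ne
    refine lt_of_le_of_lt (ENNReal.tsum_le_tsum fun i => ?_) (hδ.trans ENNReal.one_lt_top)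
    simp only [ENNReal.mul_rpow_of_nonneg _ _ hp.le, ← ENNReal.rpow_mul, inv_mul_cancel₀ hp.ne',
      ENNReal.rpow_one]
    rw [lintegral_const_mul _ ((hf i).pow_const p)]
    calc δ i / (∫⁻ x, f i x ^ p ∂μ + 1) * ∫⁻ x, f i x ^ p ∂μ
        ≤ δ i / (∫⁻ x, f i x ^ p ∂μ + 1) * (∫⁻ x, f i x ^ p ∂μ + 1) := by
          gcongr; exact le_self_add
      _ ≤ δ i := (mul_comm _ _).trans_le ENNReal.mul_div_le

/-! ### Uniform convexity of the `p`-th power -/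

section Convexity

/-- By homogeneity one may take `a + b = 1`, and compactness of `[0, 1]` together with strict
convexity supplies `c`. -/
theorem real_uniform_convexity {p : ℝ} (hp : 1 < p) {ε : ℝ} (hε : 0 < ε) :
    ∃ c : ℝ, 0 < c ∧ ∀ a b : ℝ, 0 ≤ a → 0 ≤ b →
      |a - b| ^ p + c * ((a + b) / 2) ^ p ≤ ε * (a ^ p + b ^ p) + c * ((a ^ p + b ^ p) / 2) := by
  have hp0 : 0 < p := by linarith
  have hcpow : Continuous fun x : ℝ => x ^ p := Real.continuous_rpow_const hp0.le
  set N : ℝ → ℝ := fun x => |x - (1 - x)| ^ p - ε * (x ^ p + (1 - x) ^ p) with hN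
  set D : ℝ → ℝ := fun x => (x ^ p + (1 - x) ^ p) / 2 - (1 / 2) ^ p with hD
  have hNc : Continuous N := by
    have h1 : Continuous fun x : ℝ => |x - (1 - x)| ^ p := hcpow.comp (by fun_prop)
    have h2 : Continuous fun x : ℝ => (1 - x) ^ p := hcpow.comp (by fun_prop)
    exact h1.sub (continuous_const.mul (hcpow.add h2))
  have hDc : Continuous D := by
    have h2 : Continuous fun x : ℝ => (1 - x) ^ p := hcpow.comp (by fun_prop)
    exact ((hcpow.add h2).div_const 2).sub continuous_const
  have hD0 : ∀ x ∈ Icc (0 : ℝ) 1, x ≠ 1 / 2 → 0 < D x := by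
    intro x hx hne
    have hne' : x ≠ 1 - x := fun h => hne (by linarith)
    have h1x : (1 - x) ∈ Ici (0 : ℝ) := by simpa using hx.2
    have := (strictConvexOn_rpow hp).2 hx.1 h1x hne' (one_half_pos (α := ℝ)) one_half_pos
      (by norm_num)
    simp only [smul_eq_mul] at this
    have e : (1 / 2 * x + 1 / 2 * (1 - x) : ℝ) = 1 / 2 := by ring
    rw [e] at this
    simp only [hD]; linarith
  have hD1 : ∀ x ∈ Icc (0 : ℝ) 1, 0 ≤ D x := by
    intro x hx
    by_cases h : x = 1 / 2
    · subst h; simp only [hD]; norm_num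
    · exact (hD0 x hx h).le
  have key : ∃ c : ℝ, 0 < c ∧ ∀ x ∈ Icc (0 : ℝ) 1, N x ≤ c * D x := by
    -- At `1 / 2` the function `N` is negative, so the convexity gap `D` has a positive minimum on
    -- the compact set where `N ≥ 0`. Elsewhere `N < 0 ≤ D`.
    set S : Set ℝ := Icc 0 1 ∩ N ⁻¹' Ici 0 with hS
    have hSc : IsCompact S := isCompact_Icc.inter_right (isClosed_Ici.preimage hNc)
    have hhalf : ∀ x ∈ S, x ≠ 1 / 2 := by
      rintro x ⟨_, hx⟩ rfl
      have : N (1 / 2) < 0 := by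
        have : (0 : ℝ) < (1 / 2) ^ p := by positivity
        have e' : (1 - 1 / 2 : ℝ) = 1 / 2 := by norm_num
        simp only [hN, e', sub_self, abs_zero, Real.zero_rpow hp0.ne']
        nlinarith
      exact absurd hx (not_le.2 this)
    rcases S.eq_empty_or_nonempty with he | hne
    · refine ⟨1, one_pos, fun x hx => ?_⟩
      have : N x < 0 := by
        by_contra h
        have : x ∈ S := ⟨hx, not_lt.1 h⟩
        simp [he] at this
      linarith [hD1 x hx]
    · obtain ⟨x0, hx0, hmin⟩ := hSc.exists_isMinOn hne hDc.continuousOn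
      obtain ⟨x1, hx1, hmax⟩ := hSc.exists_isMaxOn hne hNc.continuousOn
      have hd : 0 < D x0 := hD0 x0 hx0.1 (hhalf x0 hx0)
      have hn : 0 ≤ N x1 := hx1.2
      refine ⟨(N x1 + 1) / D x0, by positivity, fun x hx => ?_⟩
      by_cases hxN : 0 ≤ N x
      · have hxS : x ∈ S := ⟨hx, hxN⟩
        have h1 : N x ≤ N x1 := hmax hxS
        have h2 : D x0 ≤ D x := hmin hxS
        calc N x ≤ N x1 + 1 := by linarith
          _ = (N x1 + 1) / D x0 * D x0 := by field_simp
          _ ≤ (N x1 + 1) / D x0 * D x := by gcongr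
      · have := hD1 x hx
        have : 0 ≤ (N x1 + 1) / D x0 * D x := by positivity
        linarith
  obtain ⟨c, hc, hcx⟩ := key
  refine ⟨c, hc, fun a b ha hb => ?_⟩
  rcases (add_nonneg ha hb).eq_or_lt with h | h
  · have ha0 : a = 0 := by linarith
    have hb0 : b = 0 := by linarith
    simp [ha0, hb0, Real.zero_rpow hp0.ne']
  · obtain ⟨s, hs⟩ : ∃ s, s = a + b := ⟨_, rfl⟩
    rw [← hs] at h ⊢
    obtain ⟨x, hx⟩ : ∃ x, a = s * x := ⟨a / s, by field_simp⟩
    have hb' : b = s * (1 - x) := by linarith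
    subst hx
    have hx0 : 0 ≤ x := by
      by_contra hx; push Not at hx; nlinarith
    have hx1 : 0 ≤ 1 - x := by
      by_contra hx; push Not at hx; nlinarith
    have hk := hcx x ⟨hx0, by linarith⟩
    have e1 : |s * x - b| ^ p = s ^ p * |x - (1 - x)| ^ p := by
      rw [hb', ← mul_sub, abs_mul, abs_of_pos h, Real.mul_rpow h.le (abs_nonneg _)]
    have e2 : (s / 2) ^ p = s ^ p * (1 / 2) ^ p := by
      rw [← Real.mul_rpow h.le (by norm_num)]; congr 1; ring
    rw [e1, e2, hb', Real.mul_rpow h.le hx0, Real.mul_rpow h.le hx1]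
    have hsp : 0 ≤ s ^ p := by positivity
    have := mul_le_mul_of_nonneg_left hk hsp
    simp only [hN, hD] at this
    linarith

/-- One of the two truncated differences vanishes, so their sum is `|a - b|`. Infinite values are
harmless because `ε ≠ 0` makes the right side infinite. -/
theorem ennreal_uniform_convexity {p : ℝ} (hp : 1 < p) {ε : ℝ≥0∞} (hε : ε ≠ 0) (hε' : ε ≠ ∞) :
    ∃ c : ℝ≥0∞, c ≠ ∞ ∧ ∀ a b : ℝ≥0∞,
      ((a - b) + (b - a)) ^ p + c * ((a + b) / 2) ^ p ≤
        ε * (a ^ p + b ^ p) + c * ((a ^ p + b ^ p) / 2) := by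
  have hp0 : 0 < p := by linarith
  lift ε to ℝ≥0 using hε'
  have hεp : 0 < (ε : ℝ) := by
    have : ε ≠ 0 := by simpa using hε
    positivity
  obtain ⟨c, hc, hcx⟩ := real_uniform_convexity hp hεp
  lift c to ℝ≥0 using hc.le
  refine ⟨c, ENNReal.coe_ne_top, fun a b => ?_⟩
  rcases eq_or_ne a ∞ with rfl | ha
  · have : (ε : ℝ≥0∞) * (∞ ^ p + b ^ p) = ∞ := by
      simp [ENNReal.top_rpow_of_pos hp0, ENNReal.mul_top hε]
    simp [this]
  rcases eq_or_ne b ∞ with rfl | hb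
  · have : (ε : ℝ≥0∞) * (a ^ p + ∞ ^ p) = ∞ := by
      simp [ENNReal.top_rpow_of_pos hp0, ENNReal.mul_top hε]
    simp [this]
  lift a to ℝ≥0 using ha
  lift b to ℝ≥0 using hb
  have h2 : (2 : ℝ≥0∞) = ((2 : ℝ≥0) : ℝ≥0∞) := rfl
  rw [h2, ← ENNReal.coe_sub, ← ENNReal.coe_sub, ← ENNReal.coe_add, ← ENNReal.coe_add,
    ← ENNReal.coe_div (by norm_num), ← ENNReal.coe_rpow_of_nonneg _ hp0.le,
    ← ENNReal.coe_rpow_of_nonneg _ hp0.le, ← ENNReal.coe_rpow_of_nonneg _ hp0.le,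
    ← ENNReal.coe_rpow_of_nonneg _ hp0.le, ← ENNReal.coe_add, ← ENNReal.coe_div (by norm_num)]
  norm_cast
  rw [← NNReal.coe_le_coe]
  have := hcx a b a.2 b.2
  have e : (((a - b) + (b - a) : ℝ≥0) : ℝ) = |(a : ℝ) - b| := by
    rcases le_total a b with h | h
    · have h' : (a : ℝ) ≤ b := h
      rw [tsub_eq_zero_of_le h, zero_add, NNReal.coe_sub h, abs_of_nonpos (by linarith)]; ring
    · have h' : (b : ℝ) ≤ a := h
      rw [tsub_eq_zero_of_le h, add_zero, NNReal.coe_sub h, abs_of_nonneg (by linarith)]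
  rw [← e] at this
  push_cast at this ⊢
  exact this

end Convexity

/-! ### Comparison of measures on the line through intervals -/

theorem measure_le_of_Icc {m l : Measure ℝ} [IsFiniteMeasure l] [NullSingletonClass l]
    (h : ∀ s t, s ≤ t → m (Icc s t) ≤ l (Icc s t)) : m ≤ l := by
  have hsing : ∀ x, m {x} = 0 := fun x => by
    have := h x x le_rfl
    simpa using this
  have hna : NullSingletonClass m := ⟨hsing⟩
  have hfin : IsFiniteMeasureOnCompacts m := ⟨fun K hK => by
    obtain ⟨s, hs⟩ := hK.bddBelow
    obtain ⟨t, ht⟩ := hK.bddAbove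
    have hst : K ⊆ Icc s t := fun x hx => ⟨hs hx, ht hx⟩
    rcases le_or_gt s t with hle | hlt
    · exact (measure_mono hst).trans_lt ((h s t hle).trans_lt (measure_lt_top _ _))
    · have : K = ∅ := by rw [Icc_eq_empty (not_le.2 hlt)] at hst; exact subset_empty_iff.1 hst
      simp [this]⟩
  have hcm : Continuous fun t => ∫ _ in (0:ℝ)..t, (1 : ℝ) ∂m :=
    intervalIntegral.continuous_primitive (fun a b => by simp) 0
  have hcl : Continuous fun t => ∫ _ in (0:ℝ)..t, (1 : ℝ) ∂l :=
    intervalIntegral.continuous_primitive (fun a b => by simp) 0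
  set D : ℝ → ℝ := fun t => (∫ _ in (0:ℝ)..t, (1 : ℝ) ∂l) - ∫ _ in (0:ℝ)..t, (1 : ℝ) ∂m with hD
  have hdiff : ∀ s t, s ≤ t → D t - D s = l.real (Ioc s t) - m.real (Ioc s t) := by
    intro s t hst
    have e1 : (∫ _ in (0:ℝ)..t, (1 : ℝ) ∂l) - ∫ _ in (0:ℝ)..s, (1 : ℝ) ∂l = l.real (Ioc s t) := by
      rw [intervalIntegral.integral_interval_sub_left (by simp) (by simp),
        intervalIntegral.integral_of_le hst]
      simp
    have e2 : (∫ _ in (0:ℝ)..t, (1 : ℝ) ∂m) - ∫ _ in (0:ℝ)..s, (1 : ℝ) ∂m = m.real (Ioc s t) := by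
      rw [intervalIntegral.integral_interval_sub_left (by simp) (by simp),
        intervalIntegral.integral_of_le hst]
      simp
    simp only [hD]; linarith
  have hle : ∀ s t, s ≤ t → m (Ioc s t) ≤ l (Ioc s t) := fun s t hst => by
    rw [measure_congr Ioc_ae_eq_Icc, measure_congr (μ := l) Ioc_ae_eq_Icc]; exact h s t hst
  have hmono : Monotone D := fun s t hst => by
    have : m.real (Ioc s t) ≤ l.real (Ioc s t) :=
      ENNReal.toReal_mono (measure_ne_top _ _) (hle s t hst)
    linarith [hdiff s t hst]
  -- The difference of the distribution functions is monotone by hypothesis and continuous for lack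
  -- of atoms; its Stieltjes measure is what `l` has in excess of `m`.
  let F : StieltjesFunction ℝ := ⟨D, hmono, fun x => (hcl.sub hcm).continuousWithinAt⟩
  have hsum : l = m + F.measure := by
    refine Measure.ext_of_Ioc _ _ fun s t hst => ?_
    have hm : m (Ioc s t) ≠ ∞ := ((hle s t hst.le).trans_lt (measure_lt_top _ _)).ne
    rw [Measure.add_apply, StieltjesFunction.measure_Ioc]
    change _ = _ + ENNReal.ofReal (D t - D s)
    rw [hdiff s t hst.le, ← ENNReal.ofReal_toReal hm, ← ENNReal.ofReal_toReal (measure_ne_top l _),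
      ← ENNReal.ofReal_add ENNReal.toReal_nonneg]
    · congr 1; simp [measureReal_def]
    · exact sub_nonneg.2 (ENNReal.toReal_mono (measure_ne_top _ _) (hle s t hst.le))
  rw [hsum]
  exact Measure.le_add_right le_rfl

/-! ### Almost minimizing sequences in `L^p` -/

theorem lintegral_Lp_tsum_le {α : Type*} [MeasurableSpace α] (μ : Measure α) {p : ℝ} (hp : 1 ≤ p)
    (g : ℕ → α → ℝ≥0∞) (hg : ∀ n, Measurable (g n)) :
    (∫⁻ x, (∑' n, g n x) ^ p ∂μ) ^ (1 / p) ≤ ∑' n, (∫⁻ x, g n x ^ p ∂μ) ^ (1 / p) := by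
  have hp0 : 0 < p := by linarith
  have hfin : ∀ n, (∫⁻ x, (∑ i ∈ Finset.range n, g i x) ^ p ∂μ) ^ (1 / p) ≤
      ∑ i ∈ Finset.range n, (∫⁻ x, g i x ^ p ∂μ) ^ (1 / p) := by
    intro n
    induction n with
    | zero => simp [ENNReal.zero_rpow_of_pos hp0, hp0]
    | succ n ih =>
      rw [Finset.sum_range_succ]
      simp only [Finset.sum_range_succ]
      have hm : Measurable fun x => ∑ i ∈ Finset.range n, g i x := by fun_prop
      exact (ENNReal.lintegral_Lp_add_le hm.aemeasurable (hg n).aemeasurable hp).trans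
        (add_le_add ih le_rfl)
  have e : ∀ x, (∑' n, g n x) ^ p = ⨆ n, (∑ i ∈ Finset.range n, g i x) ^ p := fun x => by
    rw [ENNReal.tsum_eq_iSup_nat]
    exact (ENNReal.orderIsoRpow p hp0).map_iSup _
  simp only [e]
  rw [lintegral_iSup (fun n => by fun_prop) (fun m n hmn x => by
    dsimp only; gcongr)]
  have e2 : ∀ u : ℕ → ℝ≥0∞, (⨆ n, u n) ^ (1 / p) = ⨆ n, u n ^ (1 / p) := fun u =>
    (ENNReal.orderIsoRpow (1 / p) (by positivity)).map_iSup _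
  rw [e2]
  exact iSup_le fun n => (hfin n).trans (ENNReal.sum_le_tsum _)

/-- Integrated uniform convexity: two functions of nearly minimal energy `A` whose midpoint has
energy at least `A` are close in `L^p`. It matters that `δ` depends on the bound `B` and not on `A`,
since `A` varies in the application. -/
theorem exists_lintegral_sub_rpow_le {p : ℝ} (hp : 1 < p) {B η : ℝ≥0∞} (hB : B ≠ ∞) (hη : η ≠ 0)
    (hη' : η ≠ ∞) :
    ∃ δ : ℝ≥0∞, δ ≠ 0 ∧ ∀ {α : Type u} [MeasurableSpace α] (μ : Measure α) (A : ℝ≥0∞)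
      (f g : α → ℝ≥0∞), A ≤ B → Measurable f → Measurable g → ∫⁻ x, f x ^ p ∂μ ≤ A + δ →
      ∫⁻ x, g x ^ p ∂μ ≤ A + δ → A ≤ ∫⁻ x, ((f x + g x) / 2) ^ p ∂μ →
      ∫⁻ x, ((f x - g x) + (g x - f x)) ^ p ∂μ ≤ η := by
  have hB1 : B + 1 ≠ ∞ := by simpa using hB
  have h4 : 4 * (B + 1) ≠ ∞ := ENNReal.mul_ne_top (by norm_num) hB1
  -- The final bound is `ε * 2(A + δ) + c * δ`. As `A + δ ≤ B + 1`, this `ε` makes the first term at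
  -- most `η / 2`, and `δ` below does the same for the second.
  obtain ⟨c, hc, hcx⟩ := ennreal_uniform_convexity hp (ε := η / (4 * (B + 1)))
    (ENNReal.div_pos hη h4).ne' (ENNReal.div_ne_top hη' (by simp))
  have hc2 : 2 * (c + 1) ≠ ∞ := ENNReal.mul_ne_top (by norm_num) (by simpa using hc)
  set ε := η / (4 * (B + 1)) with hε
  set δ := min 1 (η / (2 * (c + 1))) with hδ
  refine ⟨δ, ?_, ?_⟩
  · exact (lt_min one_pos (ENNReal.div_pos hη hc2)).ne'
  intro α _ μ A f g hA hf hg hfA hgA hmid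
  have hint : ∫⁻ x, ((f x - g x) + (g x - f x)) ^ p ∂μ + c * ∫⁻ x, ((f x + g x) / 2) ^ p ∂μ ≤
      ε * (∫⁻ x, f x ^ p ∂μ + ∫⁻ x, g x ^ p ∂μ) +
        c * ((∫⁻ x, f x ^ p ∂μ + ∫⁻ x, g x ^ p ∂μ) / 2) := by
    have hmono := lintegral_mono (μ := μ) fun x => hcx (f x) (g x)
    have m1 : Measurable fun x => ((f x - g x) + (g x - f x)) ^ p := by fun_prop
    have m2 : Measurable fun x => ((f x + g x) / 2) ^ p := by fun_prop
    have m3 : Measurable fun x => f x ^ p + g x ^ p := by fun_prop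
    rw [lintegral_add_left m1, lintegral_const_mul _ m2, lintegral_add_left (m3.const_mul _),
      lintegral_const_mul _ m3, lintegral_const_mul _ (m3.div_const 2)] at hmono
    simp only [div_eq_mul_inv] at hmono ⊢
    rw [lintegral_mul_const _ m3, lintegral_add_left (hf.pow_const p)] at hmono
    exact hmono
  have hAt : A ≠ ∞ := ne_top_of_le_ne_top hB hA
  have h2 : ∫⁻ x, ((f x - g x) + (g x - f x)) ^ p ∂μ + c * A ≤
      (ε * (2 * (A + δ)) + c * δ) + c * A := by
    calc _ ≤ ∫⁻ x, ((f x - g x) + (g x - f x)) ^ p ∂μ + c * ∫⁻ x, ((f x + g x) / 2) ^ p ∂μ := by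
          gcongr
      _ ≤ ε * ((A + δ) + (A + δ)) + c * (((A + δ) + (A + δ)) / 2) :=
          hint.trans (by gcongr)
      _ = _ := by
          rw [← two_mul, mul_div_assoc, ENNReal.mul_div_cancel (by norm_num) (by norm_num)]
          ring
  have h3 := (ENNReal.add_le_add_iff_right (ENNReal.mul_ne_top hc hAt)).1 h2
  refine h3.trans ?_
  have hδ1 : δ ≤ 1 := min_le_left _ _
  have hδ2 : δ ≤ η / (2 * (c + 1)) := min_le_right _ _
  calc ε * (2 * (A + δ)) + c * δ ≤ ε * (2 * (B + 1)) + (c + 1) * (η / (2 * (c + 1))) := by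
        gcongr; exact le_self_add
    _ ≤ η / 2 + η / 2 := by
        gcongr
        · rw [hε, show (4 : ℝ≥0∞) * (B + 1) = 2 * (2 * (B + 1)) by ring,
            ENNReal.div_eq_inv_mul, ENNReal.mul_inv (by simp) (by simp),
            show (2 : ℝ≥0∞)⁻¹ * (2 * (B + 1))⁻¹ * η * (2 * (B + 1)) =
              ((2 * (B + 1))⁻¹ * (2 * (B + 1))) * (2⁻¹ * η) by ring,
            ENNReal.inv_mul_cancel (by simp) (ENNReal.mul_ne_top (by norm_num) hB1), one_mul,
            ENNReal.div_eq_inv_mul]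
        · rw [ENNReal.div_eq_inv_mul, ENNReal.mul_inv (by simp) (by simp),
            show (c + 1) * (2⁻¹ * (c + 1)⁻¹ * η) = ((c + 1)⁻¹ * (c + 1)) * (2⁻¹ * η) by ring,
            ENNReal.inv_mul_cancel (by simp) (by simpa using hc), one_mul,
            ENNReal.div_eq_inv_mul]
    _ = η := ENNReal.add_halves η

/-- In a decreasing sequence of midpoint convex sets of functions of bounded `p`-energy, one can
pick functions converging in `L^p` with a `p`-integrable majorant. -/
theorem exists_seq_lintegral_limsup_le {α : Type u} [MeasurableSpace α] (μ : Measure α) {p : ℝ}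
    (hp : 1 < p) (C : ℕ → Set (α → ℝ≥0∞)) (hmeas : ∀ n, ∀ f ∈ C n, Measurable f)
    (hanti : Antitone C)
    (hmid : ∀ n, ∀ f ∈ C n, ∀ g ∈ C n, (fun x => (f x + g x) / 2) ∈ C n)
    {B : ℝ≥0∞} (hB : B ≠ ∞) (hne : ∀ n, ∃ f ∈ C n, ∫⁻ x, f x ^ p ∂μ ≤ B) :
    ∃ f : ℕ → α → ℝ≥0∞, (∀ n, f n ∈ C n) ∧ ∫⁻ x, (⨆ n, f n x) ^ p ∂μ ≠ ∞ ∧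
      ∫⁻ x, (limsup (fun n => f n x) atTop) ^ p ∂μ ≤ B := by
  have hp0 : 0 < p := by linarith
  -- The infimal energies increase to a limit `A ≤ B`. Far out, the chosen functions have energy
  -- close to `a N`, while midpoints stay in `C N` and so have energy at least `a N`; hence they
  -- form a Cauchy sequence.
  set a : ℕ → ℝ≥0∞ := fun n => ⨅ f ∈ C n, ∫⁻ x, f x ^ p ∂μ with ha
  have haB : ∀ n, a n ≤ B := fun n => by
    obtain ⟨f, hf, hfB⟩ := hne n
    exact (iInf₂_le f hf).trans hfB
  have hamono : Monotone a := fun m n hmn => by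
    exact le_iInf₂ fun f hf => iInf₂_le f (hanti hmn hf)
  set A := ⨆ n, a n with hA
  have hAB : A ≤ B := iSup_le haB
  have hAt : A ≠ ∞ := ne_top_of_le_ne_top hB hAB
  have hex : ∀ n, ∃ f ∈ C n, ∫⁻ x, f x ^ p ∂μ ≤ A + ((n : ℝ≥0∞) + 1)⁻¹ := fun n => by
    have : a n < A + ((n : ℝ≥0∞) + 1)⁻¹ :=
      (le_iSup a n).trans_lt (ENNReal.lt_add_right hAt (by simp))
    simp only [ha, iInf_lt_iff] at this
    obtain ⟨f, hf, hlt⟩ := this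
    exact ⟨f, hf, hlt.le⟩
  choose g hgC hgA using hex
  have hto : Tendsto (fun n : ℕ => ((n : ℝ≥0∞) + 1)⁻¹) atTop (𝓝 0) := by
    have := ENNReal.tendsto_inv_nat_nhds_zero.comp (tendsto_add_atTop_nat 1)
    simpa [Function.comp_def] using this
  set η : ℕ → ℝ≥0∞ := fun k => ((2 : ℝ≥0∞)⁻¹ ^ k) ^ p with hη
  have hη0 : ∀ k, η k ≠ 0 := fun k => by
    simp [hη, hp0.not_gt, ENNReal.pow_eq_top_iff]
  have hηt : ∀ k, η k ≠ ∞ := fun k => ENNReal.rpow_ne_top_of_nonneg hp0.le (by simp)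
  have hcauchy : ∀ k, ∀ᶠ N in atTop, ∀ m ≥ N, ∀ n ≥ N,
      ∫⁻ x, ((g m x - g n x) + (g n x - g m x)) ^ p ∂μ ≤ η k := by
    intro k
    obtain ⟨δ, hδ0, hδ⟩ := exists_lintegral_sub_rpow_le.{u} hp hB (hη0 k) (hηt k)
    have h1 : ∀ᶠ N : ℕ in atTop, ((N : ℝ≥0∞) + 1)⁻¹ < δ / 2 :=
      hto.eventually_lt_const (ENNReal.half_pos hδ0)
    have h2 : ∀ᶠ N in atTop, A ≤ a N + δ / 2 := by
      have h3 : Tendsto (fun N => a N + δ / 2) atTop (𝓝 (A + δ / 2)) :=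
        (tendsto_atTop_iSup hamono).add tendsto_const_nhds
      refine (h3.eventually_const_lt (ENNReal.lt_add_right hAt
        (ENNReal.half_pos hδ0).ne')).mono fun _ h => h.le
    filter_upwards [h1, h2] with N hN1 hN2 m hm n hn
    have hbd : ∀ j ≥ N, ∫⁻ x, g j x ^ p ∂μ ≤ a N + δ := fun j hj => by
      calc _ ≤ A + ((j : ℝ≥0∞) + 1)⁻¹ := hgA j
        _ ≤ (a N + δ / 2) + δ / 2 := by
          gcongr
          refine le_trans ?_ hN1.le
          gcongr
        _ = a N + δ := by rw [add_assoc, ENNReal.add_halves]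
    exact hδ μ (a N) (g m) (g n) (haB N) (hmeas _ _ (hgC m)) (hmeas _ _ (hgC n)) (hbd m hm)
      (hbd n hn) (iInf₂_le _ (hmid N _ (hanti hm (hgC m)) _ (hanti hn (hgC n))))
  obtain ⟨φ, hφ, hφc⟩ := extraction_forall_of_eventually hcauchy
  set f : ℕ → α → ℝ≥0∞ := fun k => g (φ k) with hf
  have hfm : ∀ k, Measurable (f k) := fun k => hmeas _ _ (hgC _)
  set d : ℕ → α → ℝ≥0∞ := fun k x => (f k x - f (k + 1) x) + (f (k + 1) x - f k x) with hd
  have hdm : ∀ k, Measurable (d k) := fun k =>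
    ((hfm k).sub (hfm (k + 1))).add ((hfm (k + 1)).sub (hfm k))
  have hdη : ∀ k, (∫⁻ x, d k x ^ p ∂μ) ^ (1 / p) ≤ 2⁻¹ ^ k := fun k => by
    have := hφc k (φ k) le_rfl (φ (k + 1)) (hφ.monotone k.le_succ)
    calc _ ≤ (η k) ^ (1 / p) := by gcongr
      _ = 2⁻¹ ^ k := by
        simp only [hη]
        rw [← ENNReal.rpow_mul, mul_one_div_cancel hp0.ne', ENNReal.rpow_one]
  have hstep : ∀ k x, f (k + 1) x ≤ f k x + d k x := fun k x => by
    calc f (k + 1) x ≤ f k x + (f (k + 1) x - f k x) := le_add_tsub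
      _ ≤ _ := by gcongr; exact le_add_self
  have hsum : ∀ k j x, f (k + j) x ≤ f k x + ∑ i ∈ Finset.range j, d (k + i) x := by
    intro k j x
    induction j with
    | zero => simp
    | succ j ih =>
      rw [Finset.sum_range_succ]
      exact (hstep (k + j) x).trans ((add_le_add ih le_rfl).trans_eq (add_assoc _ _ _))
  -- Along a subsequence with steps of norm at most `2⁻ᵏ`, the telescoping sum bounds the whole
  -- tail. At `k = 0` it gives the integrable majorant, and as `k → ∞` the energy of the limsup.
  have hsup : ∀ k x, ⨆ j, f (k + j) x ≤ f k x + ∑' i, d (k + i) x := fun k x =>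
    iSup_le fun j => (hsum k j x).trans (by gcongr; exact ENNReal.sum_le_tsum _)
  have hnorm : ∀ k, ∫⁻ x, (⨆ j, f (k + j) x) ^ p ∂μ ≤
      ((A + ((φ k : ℝ≥0∞) + 1)⁻¹) ^ (1 / p) + 2⁻¹ ^ k * 2) ^ p := by
    intro k
    have h1 : (∫⁻ x, (f k x + ∑' i, d (k + i) x) ^ p ∂μ) ^ (1 / p) ≤
        (A + ((φ k : ℝ≥0∞) + 1)⁻¹) ^ (1 / p) + 2⁻¹ ^ k * 2 := by
      have hm : Measurable fun x => ∑' i, d (k + i) x := Measurable.tsum fun i => hdm _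
      refine (ENNReal.lintegral_Lp_add_le (hfm k).aemeasurable hm.aemeasurable hp.le).trans ?_
      gcongr
      · exact hgA _
      · refine (lintegral_Lp_tsum_le μ hp.le (fun i => d (k + i)) fun i => hdm _).trans ?_
        calc _ ≤ ∑' i : ℕ, (2⁻¹ : ℝ≥0∞) ^ k * 2⁻¹ ^ i :=
              ENNReal.tsum_le_tsum fun i => (hdη _).trans_eq (pow_add _ _ _)
          _ = 2⁻¹ ^ k * 2 := by
              rw [ENNReal.tsum_mul_left, ENNReal.tsum_geometric, ENNReal.one_sub_inv_two, inv_inv]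
    calc ∫⁻ x, (⨆ j, f (k + j) x) ^ p ∂μ ≤ ∫⁻ x, (f k x + ∑' i, d (k + i) x) ^ p ∂μ := by
          gcongr with x; exact hsup k x
      _ = ((∫⁻ x, (f k x + ∑' i, d (k + i) x) ^ p ∂μ) ^ (1 / p)) ^ p := by
          rw [← ENNReal.rpow_mul, one_div_mul_cancel hp0.ne', ENNReal.rpow_one]
      _ ≤ _ := by gcongr
  refine ⟨f, fun k => hanti hφ.le_apply (hgC _), ?_, ?_⟩
  · have := hnorm 0
    simp only [zero_add] at this
    refine ne_top_of_le_ne_top ?_ this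
    refine ENNReal.rpow_ne_top_of_nonneg hp0.le (ENNReal.add_ne_top.2 ⟨?_, by simp⟩)
    exact ENNReal.rpow_ne_top_of_nonneg (by positivity) (ENNReal.add_ne_top.2 ⟨hAt, by simp⟩)
  · refine le_trans ?_ hAB
    have hlim : Tendsto (fun k => ((A + ((φ k : ℝ≥0∞) + 1)⁻¹) ^ (1 / p) + 2⁻¹ ^ k * 2) ^ p) atTop
        (𝓝 (((A + 0) ^ (1 / p) + 0 * 2) ^ p)) := by
      refine (ENNReal.continuous_rpow_const.tendsto _).comp (Tendsto.add ?_ ?_)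
      · exact (ENNReal.continuous_rpow_const.tendsto _).comp
          (tendsto_const_nhds.add (hto.comp hφ.tendsto_atTop))
      · exact ENNReal.Tendsto.mul_const
          (ENNReal.tendsto_pow_atTop_nhds_zero_of_lt_one (by simp)) (by simp)
    rw [add_zero, zero_mul, add_zero, ← ENNReal.rpow_mul, one_div_mul_cancel hp0.ne',
      ENNReal.rpow_one] at hlim
    refine ge_of_tendsto' hlim fun k => le_trans ?_ (hnorm k)
    gcongr with x
    rw [limsup_eq_iInf_iSup_of_nat]
    refine (iInf_le _ k).trans (iSup₂_le fun i hi => ?_)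
    obtain ⟨j, rfl⟩ := Nat.exists_eq_add_of_le hi
    exact le_iSup (fun j => f (k + j) x) j

/-! ### Curves and their arc length measures -/

namespace Curve

section TopologicalSpace

variable {X : Type*} [TopologicalSpace X] (γ : Curve X)

theorem continuous_extend : Continuous γ.extend :=
  γ.path.continuous.Icc_extend'

theorem left_mem : γ.left ∈ Icc γ.left γ.right := ⟨le_rfl, γ.left_le_right⟩

theorem right_mem : γ.right ∈ Icc γ.left γ.right := ⟨γ.left_le_right, le_rfl⟩

theorem map_extend {Y : Type*} [TopologicalSpace Y] (φ : C(X, Y)) (t : ℝ) :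
    (γ.map φ).extend t = φ (γ.extend t) := rfl

/-- The restriction of a curve to a compact subinterval. -/
noncomputable def sub (s t : ℝ) (hst : s ≤ t) : Curve X where
  left := s
  right := t
  left_le_right := hst
  path := ⟨fun x => γ.extend x, γ.continuous_extend.comp continuous_subtype_val⟩

theorem sub_extend {s t : ℝ} (hst : s ≤ t) {x : ℝ} (hx : x ∈ Icc s t) :
    (γ.sub s t hst).extend x = γ.extend x :=
  IccExtend_of_mem hst (γ.sub s t hst).path hx

/-- The curve on `[a, b]` given by a function continuous on `[a, b]`. -/
noncomputable def ofContinuousOn {a b : ℝ} (hab : a ≤ b) (f : ℝ → X)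
    (hf : ContinuousOn f (Icc a b)) : Curve X where
  left := a
  right := b
  left_le_right := hab
  path := ⟨fun x => f x, continuousOn_iff_continuous_domRestrict.1 hf⟩

theorem ofContinuousOn_extend {a b : ℝ} (hab : a ≤ b) (f : ℝ → X)
    (hf : ContinuousOn f (Icc a b)) {x : ℝ} (hx : x ∈ Icc a b) :
    (ofContinuousOn hab f hf).extend x = f x :=
  IccExtend_of_mem hab (ofContinuousOn hab f hf).path hx

end TopologicalSpace

variable {X : Type*} [MetricSpace X] (γ : Curve X)

/-- The length of the restriction of `γ` to `[left, t]`. -/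
noncomputable def lengthTo (t : ℝ) : ℝ :=
  variationOnFromTo γ.extend (Icc γ.left γ.right) γ.left t

/-- A parameter at which the length travelled along `γ` equals a given value. -/
noncomputable def arcParam : ℝ → ℝ :=
  @Function.invFunOn _ _ ⟨γ.left⟩ γ.lengthTo (Icc γ.left γ.right)

theorem unitSpeed_eq : γ.unitSpeed = γ.extend ∘ γ.arcParam := rfl

/-- The arc length measure on the parameter interval of a curve. -/
noncomputable def arcMeasure : Measure ℝ :=
  (volume.restrict (Icc (0 : ℝ) γ.length.toReal)).map γ.arcParam

variable {γ}

theorem IsRectifiable.boundedVariationOn (hγ : γ.IsRectifiable) :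
    BoundedVariationOn γ.extend (Icc γ.left γ.right) := hγ

theorem IsRectifiable.lengthTo_monotoneOn (hγ : γ.IsRectifiable) : MonotoneOn γ.lengthTo (Icc γ.left γ.right) :=
  variationOnFromTo.monotoneOn hγ.boundedVariationOn.locallyBoundedVariationOn γ.left_mem

variable (γ) in
theorem lengthTo_left : γ.lengthTo γ.left = 0 := variationOnFromTo.self _ _ _

variable (γ) in
theorem lengthTo_right : γ.lengthTo γ.right = γ.length.toReal := by
  rw [lengthTo, variationOnFromTo.eq_of_le _ _ γ.left_le_right, inter_self, length]

theorem IsRectifiable.eVariationOn_Icc_ne_top (hγ : γ.IsRectifiable) {s t : ℝ} (hs : γ.left ≤ s) (ht : t ≤ γ.right) :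
    eVariationOn γ.extend (Icc s t) ≠ ∞ :=
  ne_top_of_le_ne_top hγ (eVariationOn.mono _ (Icc_subset_Icc hs ht))

theorem IsRectifiable.lengthTo_sub (hγ : γ.IsRectifiable) {s t : ℝ} (hs : γ.left ≤ s) (hst : s ≤ t) (ht : t ≤ γ.right) :
    γ.lengthTo t - γ.lengthTo s = (eVariationOn γ.extend (Icc s t)).toReal := by
  rw [lengthTo, lengthTo, variationOnFromTo.sub_right
    hγ.boundedVariationOn.locallyBoundedVariationOn γ.left_mem ⟨hs.trans hst, ht⟩
    ⟨hs, hst.trans ht⟩, variationOnFromTo.eq_of_le _ _ hst,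
    inter_eq_self_of_subset_right (Icc_subset_Icc hs ht)]

/-- For a continuous curve of bounded variation, the variation over intervals shrinking to a point
tends to zero. -/
theorem IsRectifiable.lengthTo_continuousOn (hγ : γ.IsRectifiable) : ContinuousOn γ.lengthTo (Icc γ.left γ.right) := by
  intro x hx
  have h1 := hγ.boundedVariationOn.tendsto_eVariationOn_Icc_zero_left (x := x)
    γ.continuous_extend.continuousWithinAt
  have h2 := hγ.boundedVariationOn.tendsto_eVariationOn_Icc_zero_right x
    γ.continuous_extend.continuousWithinAt
  have h3 := h1.add h2
  rw [add_zero] at h3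
  refine tendsto_iff_edist_tendsto_0.2 (tendsto_of_tendsto_of_tendsto_of_le_of_le'
    tendsto_const_nhds h3 (Eventually.of_forall fun _ => zero_le) ?_)
  filter_upwards [self_mem_nhdsWithin] with y hy
  rcases le_total y x with h | h
  · refine le_trans ?_ le_self_add
    rw [inter_eq_self_of_subset_right (Icc_subset_Icc hy.1 hx.2), edist_comm, edist_dist,
      Real.dist_eq, hγ.lengthTo_sub hy.1 h hx.2, abs_of_nonneg ENNReal.toReal_nonneg]
    exact ENNReal.ofReal_toReal_le
  · refine le_trans ?_ le_add_self
    rw [inter_eq_self_of_subset_right (Icc_subset_Icc hx.1 hy.2), edist_dist,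
      Real.dist_eq, hγ.lengthTo_sub hx.1 h hy.2, abs_of_nonneg ENNReal.toReal_nonneg]
    exact ENNReal.ofReal_toReal_le

theorem IsRectifiable.arcParam_spec (hγ : γ.IsRectifiable) {u : ℝ} (hu : u ∈ Icc 0 γ.length.toReal) :
    γ.arcParam u ∈ Icc γ.left γ.right ∧ γ.lengthTo (γ.arcParam u) = u := by
  have h := intermediate_value_Icc γ.left_le_right hγ.lengthTo_continuousOn
  rw [γ.lengthTo_left, γ.lengthTo_right] at h
  obtain ⟨x, hx, hxu⟩ := h hu
  exact @Function.invFunOn_pos _ _ (Icc γ.left γ.right) γ.lengthTo u ⟨γ.left⟩ ⟨x, hx, hxu⟩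

/-- `arcParam` picks an arbitrary parameter on each stretch where the curve is constant, but any
right inverse of a monotone function is monotone. This is what provides its measurability. -/
theorem IsRectifiable.arcParam_monotoneOn (hγ : γ.IsRectifiable) : MonotoneOn γ.arcParam (Icc 0 γ.length.toReal) := by
  intro u hu v hv huv
  by_contra hlt
  push Not at hlt
  obtain ⟨hu1, hu2⟩ := hγ.arcParam_spec hu
  obtain ⟨hv1, hv2⟩ := hγ.arcParam_spec hv
  have := hγ.lengthTo_monotoneOn hv1 hu1 hlt.le
  rw [hu2, hv2] at this
  have : u = v := le_antisymm huv this
  subst this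
  exact lt_irrefl _ hlt

theorem IsRectifiable.aemeasurable_arcParam (hγ : γ.IsRectifiable) :
    AEMeasurable γ.arcParam (volume.restrict (Icc (0 : ℝ) γ.length.toReal)) :=
  aemeasurable_restrict_of_monotoneOn measurableSet_Icc hγ.arcParam_monotoneOn

instance isFiniteMeasure_arcMeasure : IsFiniteMeasure γ.arcMeasure := by
  unfold arcMeasure; infer_instance

theorem IsRectifiable.arcMeasure_Icc (hγ : γ.IsRectifiable) {s t : ℝ} (hs : γ.left ≤ s) (hst : s ≤ t)
    (ht : t ≤ γ.right) : γ.arcMeasure (Icc s t) = eVariationOn γ.extend (Icc s t) := by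
  have hsI : s ∈ Icc γ.left γ.right := ⟨hs, hst.trans ht⟩
  have htI : t ∈ Icc γ.left γ.right := ⟨hs.trans hst, ht⟩
  have h0 : 0 ≤ γ.lengthTo s := by
    rw [← γ.lengthTo_left]; exact hγ.lengthTo_monotoneOn γ.left_mem hsI hs
  have hL : γ.lengthTo t ≤ γ.length.toReal := by
    rw [← γ.lengthTo_right]; exact hγ.lengthTo_monotoneOn htI γ.right_mem ht
  have hval : eVariationOn γ.extend (Icc s t) = ENNReal.ofReal (γ.lengthTo t - γ.lengthTo s) := by
    rw [hγ.lengthTo_sub hs hst ht, ENNReal.ofReal_toReal (hγ.eVariationOn_Icc_ne_top hs ht)]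
  rw [arcMeasure, Measure.map_apply_of_aemeasurable hγ.aemeasurable_arcParam measurableSet_Icc,
    Measure.restrict_apply₀' measurableSet_Icc.nullMeasurableSet, hval]
  -- The arc length values sent into `[s, t]` lie between the open and the closed interval with ends
  -- `lengthTo s` and `lengthTo t`; both have the same Lebesgue measure.
  refine le_antisymm ?_ ?_
  · rw [← Real.volume_Icc]
    refine measure_mono fun u hu => ?_
    obtain ⟨hu1, hu2⟩ := hγ.arcParam_spec hu.2
    rw [← hu2]
    exact ⟨hγ.lengthTo_monotoneOn hsI hu1 hu.1.1, hγ.lengthTo_monotoneOn hu1 htI hu.1.2⟩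
  · rw [← Real.volume_Ioo]
    refine measure_mono fun u hu => ?_
    have huI : u ∈ Icc 0 γ.length.toReal := ⟨h0.trans hu.1.le, hu.2.le.trans hL⟩
    obtain ⟨hu1, hu2⟩ := hγ.arcParam_spec huI
    refine ⟨⟨?_, ?_⟩, huI⟩
    · by_contra hlt
      push Not at hlt
      have := hγ.lengthTo_monotoneOn hu1 hsI hlt.le
      rw [hu2] at this
      exact absurd hu.1 (not_lt.2 this)
    · by_contra hlt
      push Not at hlt
      have := hγ.lengthTo_monotoneOn htI hu1 hlt.le
      rw [hu2] at this
      exact absurd hu.2 (not_lt.2 this)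

theorem IsRectifiable.arcMeasure_compl (hγ : γ.IsRectifiable) : γ.arcMeasure (Icc γ.left γ.right)ᶜ = 0 := by
  rw [arcMeasure, Measure.map_apply_of_aemeasurable hγ.aemeasurable_arcParam
    measurableSet_Icc.compl, Measure.restrict_apply₀' measurableSet_Icc.nullMeasurableSet]
  convert measure_empty (μ := (volume : Measure ℝ))
  exact eq_empty_of_forall_notMem fun u hu => hu.1 (hγ.arcParam_spec hu.2).1

theorem IsRectifiable.arcMeasure_inter (hγ : γ.IsRectifiable) (s : Set ℝ) :
    γ.arcMeasure (s ∩ Icc γ.left γ.right) = γ.arcMeasure s :=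
  measure_inter_conull hγ.arcMeasure_compl

theorem IsRectifiable.nullSingletonClass_arcMeasure (hγ : γ.IsRectifiable) : NullSingletonClass γ.arcMeasure := ⟨fun x => by
  by_cases hx : x ∈ Icc γ.left γ.right
  · rw [← Icc_self, hγ.arcMeasure_Icc hx.1 le_rfl hx.2, Icc_self]
    exact eVariationOn.subsingleton _ subsingleton_singleton
  · exact measure_mono_null (singleton_subset_iff.2 hx) hγ.arcMeasure_compl⟩

theorem IsRectifiable.integral_eq (hγ : γ.IsRectifiable) {ρ : X → ℝ≥0∞} [MeasurableSpace X] [BorelSpace X]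
    (hρ : Measurable ρ) : γ.integral ρ = ∫⁻ t, ρ (γ.extend t) ∂γ.arcMeasure := by
  rw [arcMeasure, lintegral_map' _ hγ.aemeasurable_arcParam]
  · rfl
  · exact (hρ.comp γ.continuous_extend.measurable).aemeasurable

theorem IsRectifiable.sub (hγ : γ.IsRectifiable) {s t : ℝ} (hs : γ.left ≤ s) (hst : s ≤ t) (ht : t ≤ γ.right) :
    (γ.sub s t hst).IsRectifiable := by
  have : (γ.sub s t hst).length = eVariationOn γ.extend (Icc s t) :=
    eVariationOn.congr fun x hx => γ.sub_extend hst hx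
  rw [IsRectifiable, this]
  exact hγ.eVariationOn_Icc_ne_top hs ht

/-- A measure dominating the increments of a rectifiable curve dominates its arc length. -/
theorem IsRectifiable.arcMeasure_le (hγ : γ.IsRectifiable) {m : Measure ℝ} [IsFiniteMeasure m] [NullSingletonClass m]
    (h : ∀ s t, γ.left ≤ s → s ≤ t → t ≤ γ.right → eVariationOn γ.extend (Icc s t) ≤ m (Icc s t)) :
    γ.arcMeasure ≤ m := by
  refine measure_le_of_Icc fun s t _ => ?_
  rw [← hγ.arcMeasure_inter, Icc_inter_Icc]
  rcases le_or_gt (max s γ.left) (min t γ.right) with hle | hlt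
  · rw [hγ.arcMeasure_Icc (le_max_right _ _) hle (min_le_right _ _)]
    exact (h _ _ (le_max_right _ _) hle (min_le_right _ _)).trans
      (measure_mono (Icc_subset_Icc (le_max_left _ _) (min_le_left _ _)))
  · rw [Icc_eq_empty (not_le.2 hlt)]; simp

theorem IsRectifiable.sub_arcMeasure (hγ : γ.IsRectifiable) {s t : ℝ} (hs : γ.left ≤ s) (hst : s ≤ t) (ht : t ≤ γ.right) :
    (γ.sub s t hst).arcMeasure = γ.arcMeasure.restrict (Icc s t) := by
  have hr := hγ.sub hs hst ht
  refine Measure.ext_of_Icc _ _ fun x y _ => ?_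
  rw [Measure.restrict_apply measurableSet_Icc, ← hr.arcMeasure_inter]
  change _ = γ.arcMeasure (Icc x y ∩ Icc s t)
  change (γ.sub s t hst).arcMeasure (Icc x y ∩ Icc s t) = _
  rw [Icc_inter_Icc]
  rcases le_or_gt (max x s) (min y t) with hle | hlt
  · rw [hγ.arcMeasure_Icc (hs.trans (le_max_right _ _)) hle ((min_le_right _ _).trans ht),
      hr.arcMeasure_Icc (s := max x s) (t := min y t) (le_max_right x s) hle (min_le_right y t)]
    exact eVariationOn.congr fun z hz => γ.sub_extend hst
      ⟨(le_max_right _ _).trans hz.1, hz.2.trans (min_le_right _ _)⟩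
  · rw [Icc_eq_empty (not_le.2 hlt)]; simp

theorem IsRectifiable.sub_integral (hγ : γ.IsRectifiable) [MeasurableSpace X] [BorelSpace X] {ρ : X → ℝ≥0∞}
    (hρ : Measurable ρ) {s t : ℝ} (hs : γ.left ≤ s) (hst : s ≤ t) (ht : t ≤ γ.right) :
    (γ.sub s t hst).integral ρ = ∫⁻ x in Icc s t, ρ (γ.extend x) ∂γ.arcMeasure := by
  rw [(hγ.sub hs hst ht).integral_eq hρ, hγ.sub_arcMeasure hs hst ht]
  exact setLIntegral_congr_fun measurableSet_Icc fun x hx => by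
    rw [γ.sub_extend hst hx]

theorem IsRectifiable.sub_integral_le (hγ : γ.IsRectifiable) [MeasurableSpace X] [BorelSpace X] {ρ : X → ℝ≥0∞}
    (hρ : Measurable ρ) {s t : ℝ} (hs : γ.left ≤ s) (hst : s ≤ t) (ht : t ≤ γ.right) :
    (γ.sub s t hst).integral ρ ≤ γ.integral ρ := by
  rw [hγ.sub_integral hρ hs hst ht, hγ.integral_eq hρ]
  exact setLIntegral_le_lintegral _ _

/-- Half-open partition intervals are disjoint, and without atoms they have the measure of the
closed ones. -/
theorem eVariationOn_Icc_le_measure {Z : Type*} [MetricSpace Z] {f : ℝ → Z} {a b : ℝ}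
    {m : Measure ℝ} [NullSingletonClass m]
    (h : ∀ s t, a ≤ s → s ≤ t → t ≤ b → edist (f s) (f t) ≤ m (Icc s t)) :
    eVariationOn f (Icc a b) ≤ m (Icc a b) := by
  refine iSup_le ?_
  rintro ⟨n, u, hu, hmem⟩
  calc ∑ i ∈ Finset.range n, edist (f (u (i + 1))) (f (u i))
      ≤ ∑ i ∈ Finset.range n, m (Ioc (u i) (u (i + 1))) := by
        refine Finset.sum_le_sum fun i _ => ?_
        rw [edist_comm, measure_congr Ioc_ae_eq_Icc]
        exact h _ _ (hmem i).1 (hu i.le_succ) (hmem (i + 1)).2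
    _ = m (⋃ i ∈ Finset.range n, Ioc (u i) (u (i + 1))) := by
        refine (measure_biUnion_finset (fun i _ j _ hij => ?_) fun i _ => measurableSet_Ioc).symm
        exact hu.pairwise_disjoint_on_Ioc_succ hij
    _ ≤ m (Icc a b) := by
        refine measure_mono (iUnion₂_subset fun i _ x hx => ?_)
        exact ⟨(hmem i).1.trans hx.1.le, hx.2.trans (hmem (i + 1)).2⟩

theorem isRectifiable_of_edist_le {m : Measure ℝ} [IsFiniteMeasure m] [NullSingletonClass m]
    (h : ∀ s t, γ.left ≤ s → s ≤ t → t ≤ γ.right →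
      edist (γ.extend s) (γ.extend t) ≤ m (Icc s t)) : γ.IsRectifiable :=
  ne_top_of_le_ne_top (measure_ne_top m _) (eVariationOn_Icc_le_measure h)

theorem arcMeasure_le_of_edist_le {m : Measure ℝ} [IsFiniteMeasure m] [NullSingletonClass m]
    (h : ∀ s t, γ.left ≤ s → s ≤ t → t ≤ γ.right →
      edist (γ.extend s) (γ.extend t) ≤ m (Icc s t)) : γ.arcMeasure ≤ m :=
  (isRectifiable_of_edist_le h).arcMeasure_le fun _ _ hs _ ht =>
    eVariationOn_Icc_le_measure fun s' t' h1 h2 h3 => h s' t' (hs.trans h1) h2 (h3.trans ht)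

/-- The increments are dominated by those of the distribution function of `m`, which is continuous
because `m` has no atoms. -/
theorem continuousOn_of_edist_le {Z : Type*} [MetricSpace Z] {f : ℝ → Z} {a b : ℝ}
    {m : Measure ℝ} [IsFiniteMeasure m] [NullSingletonClass m]
    (h : ∀ s t, a ≤ s → s ≤ t → t ≤ b → edist (f s) (f t) ≤ m (Icc s t)) :
    ContinuousOn f (Icc a b) := by
  have hc : Continuous fun t => ∫ _ in a..t, (1 : ℝ) ∂m :=
    intervalIntegral.continuous_primitive (fun a b => by simp) a
  have key : ∀ s t, a ≤ s → s ≤ t → t ≤ b →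
      edist (f s) (f t) ≤ edist (∫ _ in a..s, (1 : ℝ) ∂m) (∫ _ in a..t, (1 : ℝ) ∂m) := by
    intro s t hs hst ht
    refine (h s t hs hst ht).trans ?_
    rw [edist_comm, edist_dist, Real.dist_eq,
      intervalIntegral.integral_interval_sub_left (by simp) (by simp),
      intervalIntegral.integral_of_le hst, ← measure_congr (μ := m) Ioc_ae_eq_Icc]
    simp [measureReal_def, abs_of_nonneg, ENNReal.ofReal_toReal]
  intro x hx
  refine tendsto_iff_edist_tendsto_0.2 (tendsto_of_tendsto_of_tendsto_of_le_of_le'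
    tendsto_const_nhds (tendsto_iff_edist_tendsto_0.1 (hc.tendsto x |>.mono_left
      (nhdsWithin_le_nhds (s := Icc a b)))) (Eventually.of_forall fun _ => zero_le) ?_)
  filter_upwards [self_mem_nhdsWithin] with y hy
  rcases le_total y x with hyx | hxy
  · exact key y x hy.1 hyx hx.2
  · rw [edist_comm (f y), edist_comm (∫ _ in a..y, (1 : ℝ) ∂m)]
    exact key x y hx.1 hxy hy.2

theorem map_length_of_isometry {Y : Type*} [MetricSpace Y] {i : C(X, Y)} (hi : Isometry i) :
    (γ.map i).length = γ.length := by
  simp only [length, eVariationOn]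
  refine iSup_congr fun q => Finset.sum_congr rfl fun j _ => ?_
  rw [map_extend, map_extend, hi.edist_eq]

theorem map_integral_of_isometry {Y : Type*} [MetricSpace Y] {i : C(X, Y)} (hi : Isometry i)
    (ρ : Y → ℝ≥0∞) : (γ.map i).integral ρ = γ.integral (ρ ∘ i) := by
  have hl : (γ.map i).lengthTo = γ.lengthTo := by
    have : ∀ s : Set ℝ, eVariationOn (γ.map i).extend s = eVariationOn γ.extend s := fun s => by
      simp only [eVariationOn]
      refine iSup_congr fun q => Finset.sum_congr rfl fun j _ => ?_
      rw [map_extend, map_extend, hi.edist_eq]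
    funext t
    simp only [lengthTo, variationOnFromTo, this]
    rfl
  have hp : (γ.map i).arcParam = γ.arcParam := by
    simp only [arcParam, hl]; rfl
  rw [integral, integral, map_length_of_isometry hi]
  simp only [unitSpeed_eq, hp]
  rfl

end Curve

/-! ### Modulus and exceptional families -/

theorem Curve.integral_mono {X : Type*} [MetricSpace X] (γ : Curve X) {ρ ρ' : X → ℝ≥0∞} (h : ∀ x, ρ x ≤ ρ' x) :
    γ.integral ρ ≤ γ.integral ρ' :=
  lintegral_mono fun _ => h _

theorem Curve.integral_const_mul {X : Type*} [MetricSpace X] (γ : Curve X) {c : ℝ≥0∞} (hc : c ≠ ∞) (ρ : X → ℝ≥0∞) :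
    γ.integral (fun x => c * ρ x) = c * γ.integral ρ :=
  lintegral_const_mul' _ _ hc

theorem lintegral_sup_rpow_le {X : Type*} [MeasurableSpace X] {μ : Measure X} {p : ℝ} {f g : X → ℝ≥0∞} (hf : Measurable f) :
    ∫⁻ x, (f x ⊔ g x) ^ p ∂μ ≤ ∫⁻ x, f x ^ p ∂μ + ∫⁻ x, g x ^ p ∂μ := by
  rw [← lintegral_add_left (hf.pow_const p)]
  refine lintegral_mono fun x => ?_
  rcases le_total (f x) (g x) with h | h
  · simp only [sup_of_le_right h]; exact le_add_self
  · simp only [sup_of_le_left h]; exact le_self_add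

/-- A lower semicontinuous positive weight attains a positive minimum on the compact image of the
curve. -/
theorem Curve.integral_ne_top_of_weight {X : Type*} [MetricSpace X] (γ : Curve X) {g : X → ℝ≥0∞} {ω : X → ℝ≥0∞}
    (hω : LowerSemicontinuous ω) (hω0 : ∀ x, ω x ≠ 0)
    (hγ : γ.integral (fun x => ω x * g x) ≠ ∞) : γ.integral g ≠ ∞ := by
  have hK : IsCompact (range γ.path) := isCompact_range γ.path.continuous
  have hne : (range γ.path).Nonempty := ⟨_, ⟨γ.left, γ.left_mem⟩, rfl⟩
  obtain ⟨x, -, hmin⟩ := (hω.lowerSemicontinuousOn _).exists_isMinOn hne hK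
  intro htop
  refine hγ (top_le_iff.1 ?_)
  have hle : ω x * γ.integral g ≤ γ.integral fun y => ω y * g y := by
    refine (lintegral_const_mul_le _ _).trans (lintegral_mono fun t => ?_)
    have hmem : γ.unitSpeed t ∈ range γ.path := ⟨_, rfl⟩
    exact mul_le_mul_left (hmin hmem) _
  rwa [htop, ENNReal.mul_top (hω0 x)] at hle

section Modulus

variable {X : Type*} [MetricSpace X] [MeasurableSpace X] {μ : Measure X} {p : ℝ}

/-- Curves along which a `p`-integrable function has infinite integral do not matter for the
modulus. -/
theorem modulus_le_of_exceptional (hp : 0 < p) {Γ : Set (Curve X)} {ρ τ : X → ℝ≥0∞}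
    (hρ : Measurable ρ) (hτ : Measurable τ) (hτp : ∫⁻ x, τ x ^ p ∂μ ≠ ∞)
    (h : ∀ γ ∈ Γ, γ.IsRectifiable → γ.integral τ ≠ ∞ → 1 ≤ γ.integral ρ) :
    modulus p μ Γ ≤ ∫⁻ x, ρ x ^ p ∂μ := by
  have hle : ∀ n : ℕ, modulus p μ Γ ≤
      ∫⁻ x, ρ x ^ p ∂μ + (((n : ℝ≥0∞) + 1)⁻¹) ^ p * ∫⁻ x, τ x ^ p ∂μ := by
    intro n
    have hc0 : ((n : ℝ≥0∞) + 1)⁻¹ ≠ 0 := by simp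
    have hct : ((n : ℝ≥0∞) + 1)⁻¹ ≠ ∞ := by simp
    set c := ((n : ℝ≥0∞) + 1)⁻¹
    -- The term `c * τ` takes care of the exceptional curves, and its cost `c ^ p * ∫ τ ^ p`
    -- vanishes as `c → 0`.
    have hadm : IsAdmissible Γ fun x => ρ x ⊔ c * τ x := by
      refine ⟨hρ.sup (hτ.const_mul c), fun γ hγ hr => ?_⟩
      by_cases hi : γ.integral τ = ∞
      · refine le_trans ?_ (γ.integral_mono fun x => le_sup_right)
        rw [γ.integral_const_mul hct, hi, ENNReal.mul_top hc0]
        exact le_top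
      · exact (h γ hγ hr hi).trans (γ.integral_mono fun x => le_sup_left)
    refine (iInf₂_le _ hadm).trans ((lintegral_sup_rpow_le hρ).trans ?_)
    simp only [ENNReal.mul_rpow_of_nonneg _ _ hp.le]
    rw [lintegral_const_mul _ (hτ.pow_const p)]
  have hto : Tendsto (fun n : ℕ => ((n : ℝ≥0∞) + 1)⁻¹) atTop (𝓝 0) := by
    have := ENNReal.tendsto_inv_nat_nhds_zero.comp (tendsto_add_atTop_nat 1)
    simpa [Function.comp_def] using this
  have hlim : Tendsto (fun n : ℕ => ∫⁻ x, ρ x ^ p ∂μ +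
      (((n : ℝ≥0∞) + 1)⁻¹) ^ p * ∫⁻ x, τ x ^ p ∂μ) atTop
      (𝓝 (∫⁻ x, ρ x ^ p ∂μ + 0 ^ p * ∫⁻ x, τ x ^ p ∂μ)) :=
    tendsto_const_nhds.add (ENNReal.Tendsto.mul_const
      ((ENNReal.continuous_rpow_const.tendsto _).comp hto) (Or.inr hτp))
  rw [ENNReal.zero_rpow_of_pos hp, zero_mul, add_zero] at hlim
  exact ge_of_tendsto' hlim hle

theorem modulus_eq_zero_iff (hp : 0 < p) {Γ : Set (Curve X)} :
    modulus p μ Γ = 0 ↔ ∃ τ : X → ℝ≥0∞, Measurable τ ∧ ∫⁻ x, τ x ^ p ∂μ ≠ ∞ ∧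
      ∀ γ ∈ Γ, γ.IsRectifiable → γ.integral τ = ∞ := by
  constructor
  · intro h0
    -- With this choice `n * ρ n` has energy at most `2⁻ⁿ` but integral at least `n` along every
    -- curve of `Γ`. For `n = 0` the bound is `∞`.
    have hex : ∀ n : ℕ, ∃ ρ, IsAdmissible Γ ρ ∧
        ∫⁻ x, ρ x ^ p ∂μ ≤ 2⁻¹ ^ n / ((n : ℝ≥0∞) ^ p) := by
      intro n
      have : modulus p μ Γ < 2⁻¹ ^ n / ((n : ℝ≥0∞) ^ p) := by
        rw [h0]
        refine ENNReal.div_pos (by simp) (ENNReal.rpow_ne_top_of_nonneg hp.le (by simp))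
      simp only [modulus, iInf_lt_iff] at this
      obtain ⟨ρ, hρ, hlt⟩ := this
      exact ⟨ρ, hρ, hlt.le⟩
    choose ρ hρ hρp using hex
    have hm : ∀ n : ℕ, Measurable fun x => (n : ℝ≥0∞) * ρ n x := fun n =>
      (hρ n).1.const_mul _
    refine ⟨fun x => ⨆ n : ℕ, (n : ℝ≥0∞) * ρ n x, Measurable.iSup hm, ?_, ?_⟩
    · refine ne_top_of_le_ne_top ?_ (lintegral_iSup_rpow_le_tsum μ hp _ hm)
      refine ne_top_of_le_ne_top (b := ∑' n : ℕ, (2⁻¹ : ℝ≥0∞) ^ n) ?_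
        (ENNReal.tsum_le_tsum fun n => ?_)
      · rw [ENNReal.tsum_geometric, ENNReal.one_sub_inv_two, inv_inv]; simp
      · simp only [ENNReal.mul_rpow_of_nonneg _ _ hp.le]
        rw [lintegral_const_mul _ ((hρ n).1.pow_const p)]
        exact (mul_le_mul_right (hρp n) _).trans ENNReal.mul_div_le
    · intro γ hγ hr
      refine ENNReal.eq_top_of_forall_nnreal_le fun r => ?_
      obtain ⟨n, hn⟩ := exists_nat_ge r
      calc (r : ℝ≥0∞) ≤ n := by exact_mod_cast hn
        _ = n * 1 := (mul_one _).symm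
        _ ≤ n * γ.integral (ρ n) := by gcongr; exact (hρ n).2 γ hγ hr
        _ = γ.integral fun x => n * ρ n x := (γ.integral_const_mul (by simp) _).symm
        _ ≤ _ := γ.integral_mono fun x => le_iSup (fun n : ℕ => (n : ℝ≥0∞) * ρ n x) n
  · rintro ⟨τ, hτ, hτp, h⟩
    have := modulus_le_of_exceptional (μ := μ) (ρ := 0) hp (Γ := Γ) measurable_const hτ hτp
      fun γ hγ hr hne => absurd (h γ hγ hr) hne
    simpa [ENNReal.zero_rpow_of_pos hp] using this

/-- This expresses countable subadditivity of exceptional families: finiteness of a single integral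
excludes all of them at once. -/
theorem exists_common_exceptional {ι : Type*} [Countable ι] (hp : 0 < p) (τ : ι → X → ℝ≥0∞)
    (hτ : ∀ i, Measurable (τ i)) (hτp : ∀ i, ∫⁻ x, τ i x ^ p ∂μ ≠ ∞) :
    ∃ σ : X → ℝ≥0∞, Measurable σ ∧ ∫⁻ x, σ x ^ p ∂μ ≠ ∞ ∧
      ∀ γ : Curve X, γ.integral σ ≠ ∞ → ∀ i, γ.integral (τ i) ≠ ∞ := by
  obtain ⟨c, hc0, hct, hc⟩ := exists_lintegral_iSup_mul_rpow_ne_top μ hp τ hτ hτp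
  refine ⟨_, Measurable.iSup fun i => (hτ i).const_mul (c i), hc, fun γ hγ i hi => hγ ?_⟩
  refine top_le_iff.1 (le_trans ?_ (γ.integral_mono fun x => le_iSup (fun i => c i * τ i x) i))
  rw [γ.integral_const_mul (hct i), hi, ENNReal.mul_top (hc0 i)]

theorem exists_common_exceptional_two {τ₁ τ₂ : X → ℝ≥0∞}
    (h₁ : Measurable τ₁) (h₂ : Measurable τ₂) (h₁p : ∫⁻ x, τ₁ x ^ p ∂μ ≠ ∞)
    (h₂p : ∫⁻ x, τ₂ x ^ p ∂μ ≠ ∞) :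
    ∃ σ : X → ℝ≥0∞, Measurable σ ∧ ∫⁻ x, σ x ^ p ∂μ ≠ ∞ ∧
      ∀ γ : Curve X, γ.integral σ ≠ ∞ → γ.integral τ₁ ≠ ∞ ∧ γ.integral τ₂ ≠ ∞ :=
  ⟨fun x => τ₁ x ⊔ τ₂ x, h₁.sup h₂,
    ((lintegral_sup_rpow_le h₁).trans_lt (ENNReal.add_lt_top.2 ⟨h₁p.lt_top, h₂p.lt_top⟩)).ne,
    fun γ hγ => ⟨ne_top_of_le_ne_top hγ (γ.integral_mono fun _ => le_sup_left),
      ne_top_of_le_ne_top hγ (γ.integral_mono fun _ => le_sup_right)⟩⟩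

end Modulus

/-! ### Weak upper gradients along almost every curve -/

section UpperGradients

variable {X : Type*} [MetricSpace X] [MeasurableSpace X] {Z : Type*} [MetricSpace Z]
  {μ : Measure X} {p : ℝ} {h : X → Z} {g : X → ℝ≥0∞}

theorem isWeakUpperGradient_iff (hp : 0 < p) :
    IsWeakUpperGradient p μ h g ↔ Measurable g ∧ ∃ τ : X → ℝ≥0∞, Measurable τ ∧
      ∫⁻ x, τ x ^ p ∂μ ≠ ∞ ∧ ∀ γ : Curve X, γ.IsRectifiable → γ.integral τ ≠ ∞ →
        edist (h (γ.extend γ.left)) (h (γ.extend γ.right)) ≤ γ.integral g := by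
  refine and_congr_right fun _ => ⟨?_, ?_⟩
  · rintro ⟨N, hN, hle⟩
    obtain ⟨τ, hτ, hτp, hτN⟩ := (modulus_eq_zero_iff hp).1 hN
    exact ⟨τ, hτ, hτp, fun γ hr hγ => hle γ (fun hmem => hγ (hτN γ hmem hr)) hr⟩
  · rintro ⟨τ, hτ, hτp, hle⟩
    refine ⟨{γ | γ.integral τ = ∞}, (modulus_eq_zero_iff hp).2 ⟨τ, hτ, hτp, fun γ hγ _ => hγ⟩, ?_⟩
    exact fun γ hγ hr => hle γ hr hγ

theorem UG_subset_UGloc : UG p μ h ⊆ UGloc p μ h := fun _ hg =>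
  ⟨hg.1, fun _ => ⟨univ, isOpen_univ, mem_univ _, by simpa using hg.2⟩⟩

theorem mem_UGloc_of_le {g' : X → ℝ≥0∞} (hp : 0 < p) (hg : g ∈ UGloc p μ h)
    (hg' : IsWeakUpperGradient p μ h g') (hle : ∀ x, g' x ≤ g x) : g' ∈ UGloc p μ h := by
  refine ⟨hg', fun x => ?_⟩
  obtain ⟨U, hU, hx, hlt⟩ := hg.2 x
  refine ⟨U, hU, hx, (lintegral_mono fun y => ?_).trans_lt hlt⟩
  gcongr
  exact hle y

/-- A locally `p`-integrable function becomes `p`-integrable after multiplication with a suitable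
weight that is bounded below on compact sets. -/
theorem exists_weight [OpensMeasurableSpace X] [SecondCountableTopology X] (hp : 0 < p)
    (hg : Measurable g)
    (hloc : ∀ x : X, ∃ U : Set X, IsOpen U ∧ x ∈ U ∧ ∫⁻ y in U, g y ^ p ∂μ < ∞) :
    ∃ ω : X → ℝ≥0∞, LowerSemicontinuous ω ∧ (∀ x, ω x ≠ 0) ∧
      ∫⁻ x, (ω x * g x) ^ p ∂μ ≠ ∞ := by
  choose U hU hxU hUg using hloc
  obtain ⟨s, hs, hcover⟩ := TopologicalSpace.countable_cover_nhds fun x => (hU x).mem_nhds (hxU x)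
  have : Countable s := hs.to_subtype
  have hint : ∀ i : s, ∫⁻ x, ((U i).indicator g x) ^ p ∂μ ≠ ∞ := fun i => by
    have e : ∀ x, ((U i).indicator g x) ^ p = (U i).indicator (fun x => g x ^ p) x := fun x => by
      by_cases hx : x ∈ U i <;> simp [hx, ENNReal.zero_rpow_of_pos hp]
    simp only [e]
    rw [lintegral_indicator (hU i).measurableSet]
    exact (hUg i).ne
  obtain ⟨c, hc0, -, hc⟩ := exists_lintegral_iSup_mul_rpow_ne_top μ hp
    (fun (i : s) x => (U i).indicator g x) (fun i => hg.indicator (hU i).measurableSet) hint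
  -- The sets `U i` are open, which gives semicontinuity, and cover the space, which gives
  -- positivity.
  refine ⟨fun x => ⨆ i : s, (U i).indicator (fun _ => c i) x,
    lowerSemicontinuous_iSup fun i => (hU i).lowerSemicontinuous_indicator zero_le, fun x => ?_, ?_⟩
  · have hx : x ∈ ⋃ y ∈ s, U y := hcover ▸ mem_univ x
    obtain ⟨y, hy, hxy⟩ := mem_iUnion₂.1 hx
    refine (lt_of_lt_of_le (pos_iff_ne_zero.2 (hc0 ⟨y, hy⟩))
      (le_trans ?_ (le_iSup (fun i : s => (U i).indicator (fun _ => c i) x) ⟨y, hy⟩))).ne'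
    rw [indicator_of_mem hxy]
  · convert hc using 3 with x
    congr 1
    rw [ENNReal.iSup_mul]
    refine iSup_congr fun i => ?_
    by_cases hx : x ∈ U i <;> simp [hx]

variable [BorelSpace X] [SecondCountableTopology X]

/-- Finiteness of `∫_γ τ` is inherited by subcurves, so the upper gradient inequality holds on all
of them simultaneously. The weight turns local integrability of `g` into finiteness of `∫_γ g`. -/
theorem exists_exceptional_of_mem_UGloc (hp : 0 < p) (hg : g ∈ UGloc p μ h) :
    ∃ τ : X → ℝ≥0∞, Measurable τ ∧ ∫⁻ x, τ x ^ p ∂μ ≠ ∞ ∧ ∀ γ : Curve X, γ.IsRectifiable →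
      γ.integral τ ≠ ∞ → γ.integral g ≠ ∞ ∧ ∀ s t, γ.left ≤ s → s ≤ t → t ≤ γ.right →
        edist (h (γ.extend s)) (h (γ.extend t)) ≤
          ∫⁻ x in Icc s t, g (γ.extend x) ∂γ.arcMeasure := by
  obtain ⟨hgm, τ₁, hτ₁, hτ₁p, h₁⟩ := (isWeakUpperGradient_iff hp).1 hg.1
  obtain ⟨ω, hω, hω0, hωp⟩ := exists_weight hp hgm hg.2
  obtain ⟨τ, hτ, hτp, h₂⟩ := exists_common_exceptional_two hτ₁ (hω.measurable.mul hgm) hτ₁p hωp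
  refine ⟨τ, hτ, hτp, fun γ hr hγ => ⟨γ.integral_ne_top_of_weight hω hω0 (h₂ γ hγ).2, ?_⟩⟩
  intro s t hs hst ht
  have := h₁ (γ.sub s t hst) (hr.sub hs hst ht)
    (ne_top_of_le_ne_top (h₂ γ hγ).1 (hr.sub_integral_le hτ₁ hs hst ht))
  rw [hr.sub_integral hgm hs hst ht] at this
  have e1 : (γ.sub s t hst).extend (γ.sub s t hst).left = γ.extend s :=
    γ.sub_extend hst ⟨le_rfl, hst⟩
  have e2 : (γ.sub s t hst).extend (γ.sub s t hst).right = γ.extend t :=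
    γ.sub_extend hst ⟨hst, le_rfl⟩
  rwa [e1, e2] at this

end UpperGradients

/-! ### Arc length and densities -/

section Density

instance nullSingletonClass_withDensity (m : Measure ℝ) [NullSingletonClass m] (G : ℝ → ℝ≥0∞) :
    NullSingletonClass (m.withDensity G) :=
  ⟨fun x => withDensity_absolutelyContinuous m G (measure_singleton x)⟩

theorem isFiniteMeasure_withDensity_extend {X : Type*} [MetricSpace X] [MeasurableSpace X]
    [BorelSpace X] {γ : Curve X} (hr : γ.IsRectifiable) {g : X → ℝ≥0∞} (hg : Measurable g)
    (hγ : γ.integral g ≠ ∞) :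
    IsFiniteMeasure (γ.arcMeasure.withDensity fun t => g (γ.extend t)) := by
  rw [hr.integral_eq hg] at hγ
  exact isFiniteMeasure_withDensity hγ

/-- The gluing principle: different densities may be used on complementary Borel sets of parameters.
-/
theorem le_withDensity_piecewise {α : Type*} [MeasurableSpace α] {m l : Measure α} {G H : α → ℝ≥0∞}
    {A : Set α} (hA : MeasurableSet A)
    (hG : l.restrict A ≤ m.withDensity G) (hH : l.restrict Aᶜ ≤ m.withDensity H) (F : α → ℝ≥0∞)
    (hFG : ∀ x ∈ A, G x ≤ F x) (hFH : ∀ x ∉ A, H x ≤ F x) : l ≤ m.withDensity F := by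
  refine Measure.le_iff.2 fun E hE => ?_
  have h1 : l (E ∩ A) ≤ m.withDensity F (E ∩ A) := by
    have := hG (E ∩ A)
    rw [Measure.restrict_apply (hE.inter hA), inter_assoc, inter_self] at this
    refine this.trans ?_
    rw [withDensity_apply _ (hE.inter hA), withDensity_apply _ (hE.inter hA)]
    exact setLIntegral_mono' (hE.inter hA) fun x hx => hFG x hx.2
  have h2 : l (E \ A) ≤ m.withDensity F (E \ A) := by
    have := hH (E \ A)
    rw [Measure.restrict_apply (hE.diff hA), sdiff_eq, inter_assoc, inter_self, ← sdiff_eq] at this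
    refine this.trans ?_
    rw [withDensity_apply _ (hE.diff hA), withDensity_apply _ (hE.diff hA)]
    exact setLIntegral_mono' (hE.diff hA) fun x hx => hFH x hx.2
  rw [← measure_inter_add_sdiff E hA, ← measure_inter_add_sdiff (μ := m.withDensity F) E hA]
  exact add_le_add h1 h2

theorem Curve.edist_le_arcMeasure {X : Type*} [MetricSpace X] {c : Curve X}
    (hc : c.IsRectifiable) : edist (c.extend c.left) (c.extend c.right) ≤ c.arcMeasure univ := by
  calc _ ≤ eVariationOn c.extend (Icc c.left c.right) :=
        eVariationOn.edist_le _ c.left_mem c.right_mem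
    _ = c.arcMeasure (Icc c.left c.right) :=
        (hc.arcMeasure_Icc le_rfl c.left_le_right le_rfl).symm
    _ ≤ _ := measure_mono (subset_univ _)

end Density

/-! ### Existence of minimal weak upper gradients -/

section Minimal

variable {X : Type*} [MetricSpace X] [MeasurableSpace X] {Z : Type*} [MetricSpace Z]
  {μ : Measure X} {p : ℝ} {h : X → Z} [BorelSpace X] [SecondCountableTopology X]

/-- Along almost every `γ` the map `h ∘ γ` is a rectifiable curve whose arc length measure is below
both `g₁ ds` and `g₂ ds`. Splitting the parameters according to which density is smaller puts it
below the minimum. -/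
theorem inf_mem_UGloc {g₁ g₂ : X → ℝ≥0∞} (hp : 0 < p) (h₁ : g₁ ∈ UGloc p μ h)
    (h₂ : g₂ ∈ UGloc p μ h) : (fun x => g₁ x ⊓ g₂ x) ∈ UGloc p μ h := by
  have hm₁ : Measurable g₁ := h₁.1.1
  have hm₂ : Measurable g₂ := h₂.1.1
  refine mem_UGloc_of_le hp h₁ ((isWeakUpperGradient_iff hp).2 ⟨hm₁.inf hm₂, ?_⟩)
    fun x => inf_le_left
  obtain ⟨τ₁, hτ₁, hτ₁p, hγ₁⟩ := exists_exceptional_of_mem_UGloc hp h₁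
  obtain ⟨τ₂, hτ₂, hτ₂p, hγ₂⟩ := exists_exceptional_of_mem_UGloc hp h₂
  obtain ⟨τ, hτ, hτp, hγ⟩ := exists_common_exceptional_two hτ₁ hτ₂ hτ₁p hτ₂p
  refine ⟨τ, hτ, hτp, fun γ hr hfin => ?_⟩
  obtain ⟨hf₁, he₁⟩ := hγ₁ γ hr (hγ γ hfin).1
  obtain ⟨hf₂, he₂⟩ := hγ₂ γ hr (hγ γ hfin).2
  have := hr.nullSingletonClass_arcMeasure
  have := isFiniteMeasure_withDensity_extend hr hm₁ hf₁
  have := isFiniteMeasure_withDensity_extend hr hm₂ hf₂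
  have hc : ContinuousOn (h ∘ γ.extend) (Icc γ.left γ.right) :=
    Curve.continuousOn_of_edist_le (m := γ.arcMeasure.withDensity fun t => g₁ (γ.extend t))
      fun s t hs hst ht => by
        rw [withDensity_apply _ measurableSet_Icc]; exact he₁ s t hs hst ht
  set c := Curve.ofContinuousOn γ.left_le_right _ hc with hcdef
  have hce : ∀ x ∈ Icc γ.left γ.right, c.extend x = h (γ.extend x) := fun x hx =>
    Curve.ofContinuousOn_extend _ _ hc hx
  have hle : ∀ g : X → ℝ≥0∞, (∀ s t, γ.left ≤ s → s ≤ t → t ≤ γ.right →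
        edist (h (γ.extend s)) (h (γ.extend t)) ≤
          ∫⁻ x in Icc s t, g (γ.extend x) ∂γ.arcMeasure) →
      ∀ s t, c.left ≤ s → s ≤ t → t ≤ c.right → edist (c.extend s) (c.extend t) ≤
        (γ.arcMeasure.withDensity fun t => g (γ.extend t)) (Icc s t) := by
    intro g hg s t hs hst ht
    rw [withDensity_apply _ measurableSet_Icc, hce s ⟨hs, hst.trans ht⟩, hce t ⟨hs.trans hst, ht⟩]
    exact hg s t hs hst ht
  have hcr := Curve.isRectifiable_of_edist_le (hle g₁ he₁)
  have l₁ := Curve.arcMeasure_le_of_edist_le (hle g₁ he₁)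
  have l₂ := Curve.arcMeasure_le_of_edist_le (hle g₂ he₂)
  have hA : MeasurableSet {t | g₁ (γ.extend t) ≤ g₂ (γ.extend t)} :=
    measurableSet_le (hm₁.comp γ.continuous_extend.measurable)
      (hm₂.comp γ.continuous_extend.measurable)
  have l₃ : c.arcMeasure ≤ γ.arcMeasure.withDensity fun t => g₁ (γ.extend t) ⊓ g₂ (γ.extend t) :=
    le_withDensity_piecewise hA (Measure.restrict_le_self.trans l₁)
      (Measure.restrict_le_self.trans l₂) _ (fun x hx => le_inf le_rfl hx)
      fun x hx => le_inf (not_le.1 hx).le le_rfl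
  rw [hr.integral_eq (ρ := fun x => g₁ x ⊓ g₂ x) (hm₁.inf hm₂)]
  calc edist (h (γ.extend γ.left)) (h (γ.extend γ.right))
      = edist (c.extend c.left) (c.extend c.right) := by
        rw [hce c.left γ.left_mem, hce c.right γ.right_mem]; rfl
    _ ≤ c.arcMeasure univ := Curve.edist_le_arcMeasure hcr
    _ ≤ _ := l₃ univ
    _ = _ := by rw [withDensity_apply _ MeasurableSet.univ, Measure.restrict_univ]

/-- Monotone convergence from above along each curve, permitted because `v 0` has finite integral
along almost every curve. -/
theorem iInf_mem_UGloc (hp : 0 < p) {v : ℕ → X → ℝ≥0∞} (hv : ∀ n, v n ∈ UGloc p μ h)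
    (hanti : Antitone v) : (fun x => ⨅ n, v n x) ∈ UGloc p μ h := by
  have hm : ∀ n, Measurable (v n) := fun n => (hv n).1.1
  refine mem_UGloc_of_le hp (hv 0) ((isWeakUpperGradient_iff hp).2 ⟨Measurable.iInf hm, ?_⟩)
    fun x => iInf_le _ 0
  choose τ hτ hτp hγ using fun n => exists_exceptional_of_mem_UGloc hp (hv n)
  obtain ⟨σ, hσ, hσp, hσγ⟩ := exists_common_exceptional hp τ hτ hτp
  refine ⟨σ, hσ, hσp, fun γ hr hfin => ?_⟩
  rw [hr.integral_eq (Measurable.iInf hm), lintegral_iInf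
    (f := fun n x => v n (γ.extend x))
    (fun n => (hm n).comp γ.continuous_extend.measurable) (fun m n hmn x => hanti hmn _)]
  · refine le_iInf fun n => ?_
    have := (hγ n γ hr (hσγ γ hfin n)).2 γ.left γ.right le_rfl γ.left_le_right le_rfl
    exact this.trans (setLIntegral_le_lintegral _ _)
  · have := (hγ 0 γ hr (hσγ γ hfin 0)).1
    rwa [hr.integral_eq (hm 0)] at this

/-- A map with a locally `p`-integrable weak upper gradient has a minimal one. -/
theorem exists_isMinimalUpperGradient (hp : 0 < p) (hne : (UGloc p μ h).Nonempty) :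
    ∃ ρ, IsMinimalUpperGradient p μ h ρ := by
  obtain ⟨g₀, hg₀⟩ := hne
  obtain ⟨ω, hω, hω0, hωp⟩ := exists_weight hp hg₀.1.1 hg₀.2
  set J : (X → ℝ≥0∞) → ℝ≥0∞ := fun g => ∫⁻ x, (ω x * g x) ^ p ∂μ with hJ
  have hJmono : ∀ {f g : X → ℝ≥0∞}, (∀ x, f x ≤ g x) → J f ≤ J g := fun {f g} hfg =>
    lintegral_mono fun x => by
      dsimp only
      gcongr
      exact hfg x
  set a := ⨅ g ∈ UGloc p μ h, J g with ha
  have hat : a ≠ ∞ := ne_top_of_le_ne_top hωp (iInf₂_le g₀ hg₀)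
  have hex : ∀ n : ℕ, ∃ u ∈ UGloc p μ h, J u ≤ a + ((n : ℝ≥0∞) + 1)⁻¹ := fun n => by
    have : a < a + ((n : ℝ≥0∞) + 1)⁻¹ := ENNReal.lt_add_right hat (by simp)
    rw [ha] at this
    simp only [iInf_lt_iff] at this
    obtain ⟨u, hu, hlt⟩ := this
    exact ⟨u, hu, hlt.le⟩
  choose u hu hua using hex
  -- Running minima of a minimizing sequence for the weighted energy `J`; their decreasing limit is
  -- a minimizer.
  let v : ℕ → X → ℝ≥0∞ := fun n => Nat.rec (u 0) (fun k w x => w x ⊓ u (k + 1) x) n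
  have hv : ∀ n, v n ∈ UGloc p μ h := fun n => by
    induction n with
    | zero => exact hu 0
    | succ n ih => exact inf_mem_UGloc hp ih (hu (n + 1))
  have hanti : Antitone v := antitone_nat_of_succ_le fun n x => inf_le_left
  have hvu : ∀ n x, v n x ≤ u n x := fun n x => by
    cases n with
    | zero => exact le_rfl
    | succ n => exact inf_le_right
  have hρ := iInf_mem_UGloc hp hv hanti
  set ρ : X → ℝ≥0∞ := fun x => ⨅ n, v n x with hρdef
  have hto : Tendsto (fun n : ℕ => a + ((n : ℝ≥0∞) + 1)⁻¹) atTop (𝓝 (a + 0)) := by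
    have := ENNReal.tendsto_inv_nat_nhds_zero.comp (tendsto_add_atTop_nat 1)
    exact tendsto_const_nhds.add (by simpa [Function.comp_def] using this)
  rw [add_zero] at hto
  have hJρ : J ρ ≤ a := ge_of_tendsto' hto fun n =>
    (hJmono fun x => (iInf_le _ n).trans (hvu n x)).trans (hua n)
  refine ⟨ρ, hρ, fun g hg => ?_⟩
  have hmin := inf_mem_UGloc hp hρ hg
  have hle : (fun x => (ω x * (ρ x ⊓ g x)) ^ p) ≤ᵐ[μ] fun x => (ω x * ρ x) ^ p :=
    Eventually.of_forall fun x => by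
      dsimp only
      gcongr
      exact inf_le_left
  have hJt : J ρ ≠ ∞ := ne_top_of_le_ne_top hat hJρ
  have hmeas : Measurable fun x => (ω x * ρ x) ^ p := (hω.measurable.mul hρ.1.1).pow_const p
  -- Passing to `ρ ⊓ g` cannot lower the minimal energy, and the energy is finite, so the two
  -- integrands agree almost everywhere.
  have hJmin : J ρ ≤ J fun x => ρ x ⊓ g x := hJρ.trans (iInf₂_le _ hmin)
  have heq := ae_eq_of_ae_le_of_lintegral_le hle (ne_top_of_le_ne_top hJt (hJmono fun x =>
    inf_le_left)) hmeas.aemeasurable hJmin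
  filter_upwards [heq, ae_lt_top hmeas hJt] with x hx hxt
  have hx' : ω x * (ρ x ⊓ g x) = ω x * ρ x := ENNReal.rpow_left_injective hp.ne' hx
  have hne : ω x * ρ x ≠ ∞ := fun h0 => by simp [h0, ENNReal.top_rpow_of_pos hp] at hxt
  -- The weight is a supremum and may be infinite, in which case finite energy forces `ρ x = 0`.
  by_cases hωt : ω x = ∞
  · have : ρ x = 0 := by
      by_contra h0
      exact hne (by rw [hωt, ENNReal.top_mul h0])
    rw [this]; exact zero_le
  · have := (ENNReal.mul_right_inj (hω0 x) hωt).1 hx'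
    exact inf_eq_left.1 this

end Minimal

/-! ### Passage between a subset and the ambient space -/

section Subspace

variable {X : Type*} [MeasurableSpace X] {μ : Measure X} {s : Set X}

theorem lintegral_subspaceMeasure (hs : MeasurableSet s) (f : X → ℝ≥0∞) :
    ∫⁻ x, f x ∂subspaceMeasure μ s = ∫⁻ x in s, f x ∂μ :=
  lintegral_subtype_comap hs f

theorem lintegral_subspaceMeasure_le (hs : MeasurableSet s) (f : X → ℝ≥0∞) :
    ∫⁻ x, f x ∂subspaceMeasure μ s ≤ ∫⁻ x, f x ∂μ :=
  (lintegral_subspaceMeasure hs f).trans_le (setLIntegral_le_lintegral _ _)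

theorem exists_measurable_extension_by_zero (hs : MeasurableSet s) {g : s → ℝ≥0∞}
    (hg : Measurable g) : ∃ G : X → ℝ≥0∞, Measurable G ∧ (∀ x : s, G x = g x) ∧
      ∀ x ∉ s, G x = 0 := by
  have he := MeasurableEmbedding.subtype_coe hs
  refine ⟨Function.extend Subtype.val g fun _ => 0, he.measurable_extend hg measurable_const,
    fun x => Subtype.val_injective.extend_apply _ _ _, fun x hx => ?_⟩
  exact Function.extend_apply' _ _ _ fun ⟨a, ha⟩ => hx (ha ▸ a.2)

theorem lintegral_eq_lintegral_subspaceMeasure (hs : MeasurableSet s) {g : s → ℝ≥0∞}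
    {G : X → ℝ≥0∞} (hG : ∀ x : s, G x = g x) (hG0 : ∀ x ∉ s, G x = 0) :
    ∫⁻ x, G x ∂μ = ∫⁻ x, g x ∂subspaceMeasure μ s := by
  simp only [← hG]
  rw [lintegral_subspaceMeasure hs, ← lintegral_indicator hs]
  refine lintegral_congr fun x => ?_
  by_cases hx : x ∈ s <;> simp [hx, hG0]

theorem lintegral_rpow_eq_lintegral_subspaceMeasure {p : ℝ} (hp : 0 < p) (hs : MeasurableSet s)
    {g : s → ℝ≥0∞} {G : X → ℝ≥0∞} (hG : ∀ x : s, G x = g x) (hG0 : ∀ x ∉ s, G x = 0) :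
    ∫⁻ x, G x ^ p ∂μ = ∫⁻ x, g x ^ p ∂subspaceMeasure μ s :=
  lintegral_eq_lintegral_subspaceMeasure hs (fun x => by rw [hG])
    fun x hx => by rw [hG0 x hx, ENNReal.zero_rpow_of_pos hp]

end Subspace

section SubspaceCurves

variable {X : Type*} [MetricSpace X] {s : Set X}

/-- The inclusion of a subset as a continuous map. -/
def inclusionMap (s : Set X) : C(s, X) := ⟨Subtype.val, continuous_subtype_val⟩

theorem isometry_inclusionMap (s : Set X) : Isometry (inclusionMap s) := isometry_subtype_coe

theorem Curve.isRectifiable_map_inclusionMap {γ : Curve s} :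
    (γ.map (inclusionMap s)).IsRectifiable ↔ γ.IsRectifiable := by
  simp only [Curve.IsRectifiable, Curve.map_length_of_isometry (isometry_inclusionMap s)]

theorem Curve.map_inclusionMap_integral {γ : Curve s} {g : s → ℝ≥0∞} {G : X → ℝ≥0∞}
    (hG : ∀ x : s, G x = g x) : (γ.map (inclusionMap s)).integral G = γ.integral g := by
  rw [Curve.map_integral_of_isometry (isometry_inclusionMap s)]
  exact congrArg _ (funext hG)

theorem Curve.exists_lift (γ : Curve X) (h : ∀ t, γ.path t ∈ s) :
    ∃ γ' : Curve s, γ'.map (inclusionMap s) = γ :=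
  ⟨⟨γ.left, γ.right, γ.left_le_right, ⟨fun t => ⟨γ.path t, h t⟩, by fun_prop⟩⟩, rfl⟩

end SubspaceCurves

/-! ### Consequences of the energy bound -/

section ChainRule

variable {X : Type u} [MetricSpace X] [MeasurableSpace X] [BorelSpace X]
  {Y : Type v} [MetricSpace Y] {μ : Measure X} {p : ℝ} {φ : C(X, Y)} {ρ : X → ℝ≥0∞}

/-- The metric form of `|(φ ∘ γ)'| ≤ ρ(γ) |γ'|`: the upper gradient inequality on all subcurves is
an inequality between measures. -/
theorem exists_exceptional_map [SecondCountableTopology X] (hp : 0 < p) (hρ : ρ ∈ UGloc p μ φ) :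
    ∃ τ : X → ℝ≥0∞, Measurable τ ∧ ∫⁻ x, τ x ^ p ∂μ ≠ ∞ ∧ ∀ γ : Curve X, γ.IsRectifiable →
      γ.integral τ ≠ ∞ → (γ.map φ).IsRectifiable ∧
        (γ.map φ).arcMeasure ≤ γ.arcMeasure.withDensity fun t => ρ (γ.extend t) := by
  obtain ⟨τ, hτ, hτp, h⟩ := exists_exceptional_of_mem_UGloc hp hρ
  refine ⟨τ, hτ, hτp, fun γ hr hγ => ?_⟩
  obtain ⟨hfin, he⟩ := h γ hr hγ
  have := hr.nullSingletonClass_arcMeasure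
  have := isFiniteMeasure_withDensity_extend hr hρ.1.1 hfin
  have hle : ∀ s t, (γ.map φ).left ≤ s → s ≤ t → t ≤ (γ.map φ).right →
      edist ((γ.map φ).extend s) ((γ.map φ).extend t) ≤
        (γ.arcMeasure.withDensity fun t => ρ (γ.extend t)) (Icc s t) := by
    intro s t hs hst ht
    rw [withDensity_apply _ measurableSet_Icc]
    exact he s t hs hst ht
  exact ⟨Curve.isRectifiable_of_edist_le hle, Curve.arcMeasure_le_of_edist_le hle⟩

variable [MeasurableSpace Y] {ν : Measure Y} {K : ℝ≥0}

/-- The minimal weak upper gradient inherits the energy inequality from any other locally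
`p`-integrable weak upper gradient. -/
theorem exists_minimal_of_mem_UGloc [SecondCountableTopology X] (hp : 0 < p) (hρ : ρ ∈ UGloc p μ φ)
    (hE : ∀ E : Set Y, MeasurableSet E → ∫⁻ x in φ ⁻¹' E, ρ x ^ p ∂μ ≤ K * ν E) :
    MemDirichletLoc p μ φ ∧ ∃ ρ : X → ℝ≥0∞, IsMinimalUpperGradient p μ φ ρ ∧
      ∀ E : Set Y, MeasurableSet E → ∫⁻ x in φ ⁻¹' E, ρ x ^ p ∂μ ≤ K * ν E := by
  obtain ⟨r, hr⟩ := exists_isMinimalUpperGradient hp ⟨ρ, hρ⟩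
  refine ⟨⟨⟨⟨∅, measure_empty, ?_⟩, fun U hU =>
    (hU.preimage φ.continuous).measurableSet.nullMeasurableSet⟩, ρ, hρ⟩, r, hr, fun E hEm => ?_⟩
  · rw [compl_empty, image_univ]
    exact TopologicalSpace.isSeparable_range φ.continuous
  · refine le_trans (lintegral_mono_ae ?_) (hE E hEm)
    filter_upwards [ae_restrict_of_ae (hr.2 ρ hρ)] with x hx
    gcongr

variable [BorelSpace Y]

theorem Curve.integral_map_le {γ : Curve X} (hr : γ.IsRectifiable)
    (hr' : (γ.map φ).IsRectifiable) (hρ : Measurable ρ)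
    (hle : (γ.map φ).arcMeasure ≤ γ.arcMeasure.withDensity fun t => ρ (γ.extend t))
    {σ : Y → ℝ≥0∞} (hσ : Measurable σ) :
    (γ.map φ).integral σ ≤ γ.integral fun x => σ (φ x) * ρ x := by
  have hφ : Measurable φ := φ.continuous.measurable
  have hm : Measurable γ.extend := γ.continuous_extend.measurable
  rw [hr'.integral_eq hσ, hr.integral_eq (ρ := fun x => σ (φ x) * ρ x) ((hσ.comp hφ).mul hρ)]
  refine (lintegral_mono' hle le_rfl).trans ?_
  refine (lintegral_withDensity_eq_lintegral_mul _ (hρ.comp hm) (hσ.comp (hφ.comp hm))).trans_le ?_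
  exact lintegral_mono fun t => (mul_comm _ _).le

/-- The energy bound says exactly that the push-forward of `ρ ^ p μ` under `φ` is at most `K ν`. -/
theorem lintegral_comp_mul_le (hρ : Measurable ρ)
    (hE : ∀ E : Set Y, MeasurableSet E → ∫⁻ x in φ ⁻¹' E, ρ x ^ p ∂μ ≤ K * ν E)
    {σ : Y → ℝ≥0∞} (hσ : Measurable σ) :
    ∫⁻ x, σ (φ x) * ρ x ^ p ∂μ ≤ K * ∫⁻ y, σ y ∂ν := by
  have hφ : Measurable φ := φ.continuous.measurable
  have hle : (μ.withDensity fun x => ρ x ^ p).map φ ≤ (K : ℝ≥0∞) • ν := by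
    refine Measure.le_iff.2 fun E hEm => ?_
    rw [Measure.map_apply hφ hEm, withDensity_apply _ (hφ hEm)]
    exact hE E hEm
  calc ∫⁻ x, σ (φ x) * ρ x ^ p ∂μ
      = ∫⁻ y, σ y ∂((μ.withDensity fun x => ρ x ^ p).map φ) := by
        rw [lintegral_map hσ hφ]
        refine Eq.trans (lintegral_congr fun x => mul_comm _ _)
          (lintegral_withDensity_eq_lintegral_mul _ (hρ.pow_const p) (hσ.comp hφ)).symm
    _ ≤ ∫⁻ y, σ y ∂((K : ℝ≥0∞) • ν) := lintegral_mono' hle le_rfl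
    _ = K * ∫⁻ y, σ y ∂ν := by rw [lintegral_smul_measure, smul_eq_mul]

theorem lintegral_comp_mul_rpow_le (hp : 0 < p) (hρ : Measurable ρ)
    (hE : ∀ E : Set Y, MeasurableSet E → ∫⁻ x in φ ⁻¹' E, ρ x ^ p ∂μ ≤ K * ν E)
    {σ : Y → ℝ≥0∞} (hσ : Measurable σ) :
    ∫⁻ x, (σ (φ x) * ρ x) ^ p ∂μ ≤ K * ∫⁻ y, σ y ^ p ∂ν := by
  simp only [ENNReal.mul_rpow_of_nonneg _ _ hp.le]
  exact lintegral_comp_mul_le hρ hE (hσ.pow_const p)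

theorem outerDilatation_le [SecondCountableTopology X] (hp : 0 < p) (hρ : ρ ∈ UGloc p μ φ)
    (hE : ∀ E : Set Y, MeasurableSet E → ∫⁻ x in φ ⁻¹' E, ρ x ^ p ∂μ ≤ K * ν E) :
    outerDilatation p μ ν φ ≤ K := by
  obtain ⟨τ, hτ, hτp, hγ⟩ := exists_exceptional_map hp hρ
  have hφ : Measurable φ := φ.continuous.measurable
  -- Using `C > K` keeps the constant nonzero. If `φ Γ` contains a constant curve, it has no
  -- admissible function and infinite modulus, and for `K = 0` the product `0 * ∞ = 0` would make
  -- the inequality fail in general.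
  have key : ∀ C : ℝ≥0, K < C → outerDilatation p μ ν φ ≤ C := by
    intro C hC
    refine iInf₂_le C fun Γ => ?_
    have hC0 : (C : ℝ≥0∞) ≠ 0 := by
      have : C ≠ 0 := (lt_of_le_of_lt (zero_le (a := K)) hC).ne'
      exact_mod_cast this
    have hle : ∀ σ, IsAdmissible (Curve.map φ '' Γ) σ →
        modulus p μ Γ ≤ C * ∫⁻ y, σ y ^ p ∂ν := by
      rintro σ ⟨hσ, hadm⟩
      calc modulus p μ Γ ≤ ∫⁻ x, (σ (φ x) * ρ x) ^ p ∂μ := by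
            refine modulus_le_of_exceptional hp ((hσ.comp hφ).mul hρ.1.1) hτ hτp
              fun γ hmem hr hfin => ?_
            obtain ⟨hr', hle⟩ := hγ γ hr hfin
            exact (hadm _ ⟨γ, hmem, rfl⟩ hr').trans
              (Curve.integral_map_le hr hr' hρ.1.1 hle hσ)
        _ ≤ K * ∫⁻ y, σ y ^ p ∂ν := lintegral_comp_mul_rpow_le hp hρ.1.1 hE hσ
        _ ≤ _ := by gcongr
    have hdiv : modulus p μ Γ / C ≤ modulus p ν (Curve.map φ '' Γ) :=
      le_iInf₂ fun σ hσ => ENNReal.div_le_of_le_mul' (hle σ hσ)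
    rw [mul_comm]
    exact (ENNReal.div_le_iff hC0 ENNReal.coe_ne_top).1 hdiv
  refine le_of_forall_gt_imp_ge_of_dense fun C hC => ?_
  rcases eq_or_ne C ∞ with rfl | hCt
  · exact le_top
  · lift C to ℝ≥0 using hCt
    exact key C (by exact_mod_cast hC)

/-- Chain rule: if `r` is minimal for `h`, then `(r ∘ φ) ρ` is a weak upper gradient of `h ∘ φ`,
hence bounds the minimal one. -/
theorem pullsBackDirichlet [SecondCountableTopology X] [SecondCountableTopology Y] (hp : 0 < p) (hρ : ρ ∈ UGloc p μ φ)
    (hE : ∀ E : Set Y, MeasurableSet E → ∫⁻ x in φ ⁻¹' E, ρ x ^ p ∂μ ≤ K * ν E)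
    {Ω : Set Y} (hΩ : MeasurableSet Ω) : PullsBackDirichlet.{u, v, w} p μ ν φ K Ω := by
  intro Z _ h hh
  have hφ : Measurable φ := φ.continuous.measurable
  have hΩ' : MeasurableSet (φ ⁻¹' Ω) := hφ hΩ
  have hφΩ : Measurable (Ω.restrictPreimage φ) :=
    (φ.continuous.restrictPreimage (s := Ω)).measurable
  obtain ⟨g₀, hg₀⟩ := hh.2
  obtain ⟨r, hr⟩ := exists_isMinimalUpperGradient hp ⟨g₀, UG_subset_UGloc hg₀⟩
  have hrm : Measurable r := hr.1.1.1
  have hrp : ∫⁻ y, r y ^ p ∂subspaceMeasure ν Ω ≠ ∞ := by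
    refine ne_top_of_le_ne_top hg₀.2.ne (lintegral_mono_ae ?_)
    filter_upwards [hr.2 g₀ (UG_subset_UGloc hg₀)] with y hy
    gcongr
  obtain ⟨R, hR, hRr, hR0⟩ := exists_measurable_extension_by_zero hΩ hrm
  set G : φ ⁻¹' Ω → ℝ≥0∞ := fun x => r (Ω.restrictPreimage φ x) * ρ x with hG
  have hGm : Measurable G := (hrm.comp hφΩ).mul (hρ.1.1.comp measurable_subtype_coe)
  have hGR : ∀ x : φ ⁻¹' Ω, R (φ x) * ρ x = G x := fun x => by
    simp only [hG, ← hRr]; rfl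
  have hGUG : G ∈ UG p (subspaceMeasure μ (φ ⁻¹' Ω)) (h ∘ Ω.restrictPreimage φ) := by
    refine ⟨(isWeakUpperGradient_iff hp).2 ⟨hGm, ?_⟩, ?_⟩
    · obtain ⟨-, τh, hτh, hτhp, hγh⟩ := (isWeakUpperGradient_iff hp).1 hr.1.1
      obtain ⟨T, hT, hTτ, hT0⟩ := exists_measurable_extension_by_zero hΩ hτh
      obtain ⟨τφ, hτφ, hτφp, hγφ⟩ := exists_exceptional_map hp hρ
      -- The weight that detects exceptional curves for `h` is pulled back as `(T ∘ φ) ρ`, whose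
      -- energy is finite. If its integral along `γ` is finite, then `φ ∘ γ` is not exceptional.
      have hT1 : ∫⁻ x, (T (φ x) * ρ x) ^ p ∂μ ≠ ∞ := by
        refine ne_top_of_le_ne_top ?_ (lintegral_comp_mul_rpow_le hp hρ.1.1 hE hT)
        rw [lintegral_rpow_eq_lintegral_subspaceMeasure hp hΩ hTτ hT0]
        exact ENNReal.mul_ne_top ENNReal.coe_ne_top hτhp
      obtain ⟨τ, hτ, hτp, hγ⟩ := exists_common_exceptional_two hτφ
        ((hT.comp hφ).mul hρ.1.1) hτφp hT1
      refine ⟨fun x => τ x, hτ.comp measurable_subtype_coe,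
        ne_top_of_le_ne_top hτp (lintegral_subspaceMeasure_le hΩ' fun x => τ x ^ p), ?_⟩
      intro γ hγr hfin
      set γ₁ := γ.map (inclusionMap (φ ⁻¹' Ω)) with hγ₁
      have hr₁ : γ₁.IsRectifiable := Curve.isRectifiable_map_inclusionMap.2 hγr
      have hfin₁ : γ₁.integral τ ≠ ∞ := by
        rwa [Curve.map_inclusionMap_integral (g := fun x => τ x) fun _ => rfl]
      obtain ⟨hf₁, hf₂⟩ := hγ γ₁ hfin₁
      obtain ⟨hr₂, hle⟩ := hγφ γ₁ hr₁ hf₁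
      let φΩ : C(φ ⁻¹' Ω, Ω) := ⟨Ω.restrictPreimage φ, φ.continuous.restrictPreimage⟩
      have hcomm : (γ.map φΩ).map (inclusionMap Ω) = γ₁.map φ := rfl
      have hr₃ : (γ.map φΩ).IsRectifiable := by
        rw [← Curve.isRectifiable_map_inclusionMap, hcomm]; exact hr₂
      have hf₃ : (γ.map φΩ).integral τh ≠ ∞ := by
        rw [← Curve.map_inclusionMap_integral hTτ, hcomm]
        exact ne_top_of_le_ne_top hf₂ (Curve.integral_map_le hr₁ hr₂ hρ.1.1 hle hT)
      have h1 := hγh _ hr₃ hf₃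
      rw [← Curve.map_inclusionMap_integral hRr, hcomm] at h1
      have h2 := h1.trans (Curve.integral_map_le hr₁ hr₂ hρ.1.1 hle hR)
      rwa [Curve.map_inclusionMap_integral hGR] at h2
    · simp only [← hGR]
      refine (lintegral_subspaceMeasure_le hΩ' fun x => (R (φ x) * ρ x) ^ p).trans_lt ?_
      refine (lintegral_comp_mul_rpow_le hp hρ.1.1 hE hR).trans_lt ?_
      rw [lintegral_rpow_eq_lintegral_subspaceMeasure hp hΩ hRr hR0]
      exact ENNReal.mul_lt_top ENNReal.coe_lt_top hrp.lt_top
  obtain ⟨r', hr'⟩ := exists_isMinimalUpperGradient hp ⟨G, UG_subset_UGloc hGUG⟩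
  refine ⟨⟨G, hGUG⟩, fun hm => ⟨hm, G, hGUG⟩, r, r', hr, hr', fun g hg _ => ?_⟩
  -- The product `g * r ^ p` is extended as a whole, because `g` alone need not be Borel.
  obtain ⟨S, hS, hSg, hS0⟩ := exists_measurable_extension_by_zero hΩ hg
  calc ∫⁻ x, g (Ω.restrictPreimage φ x) * r' x ^ p ∂subspaceMeasure μ (φ ⁻¹' Ω)
      ≤ ∫⁻ x : φ ⁻¹' Ω, S (φ x) * ρ x ^ p ∂subspaceMeasure μ (φ ⁻¹' Ω) := by
        refine lintegral_mono_ae ?_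
        filter_upwards [hr'.2 G (UG_subset_UGloc hGUG)] with x hx
        have e : S (φ x) = g (Ω.restrictPreimage φ x) * r (Ω.restrictPreimage φ x) ^ p :=
          hSg (Ω.restrictPreimage φ x)
        rw [e, mul_assoc, ← ENNReal.mul_rpow_of_nonneg _ _ hp.le]
        gcongr
    _ ≤ ∫⁻ x, S (φ x) * ρ x ^ p ∂μ := lintegral_subspaceMeasure_le hΩ' fun x => S (φ x) * ρ x ^ p
    _ ≤ K * ∫⁻ y, S y ∂ν := lintegral_comp_mul_le hρ.1.1 hE hS
    _ = _ := by rw [lintegral_eq_lintegral_subspaceMeasure hΩ hSg hS0]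

end ChainRule

/-! ### From the dilatation bound to weights on the domain -/

/-- If every subinterval of `m₁`-measure at least `δ` has `m₂`-measure at least `δ`, then `m₁`
exceeds `m₂` by at most `δ`. -/
theorem measure_Icc_le_add {m₁ m₂ : Measure ℝ} [IsFiniteMeasure m₁] [NullSingletonClass m₁]
    [NullSingletonClass m₂] {a b : ℝ} (hab : a ≤ b) {δ : ℝ≥0∞} (hδ0 : δ ≠ 0) (hδt : δ ≠ ∞)
    (h : ∀ s t, a ≤ s → s ≤ t → t ≤ b → δ ≤ m₁ (Icc s t) → δ ≤ m₂ (Icc s t)) :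
    m₁ (Icc a b) ≤ m₂ (Icc a b) + δ := by
  have hadd : ∀ (m : Measure ℝ) [NullSingletonClass m] {s t : ℝ}, s ≤ t → t ≤ b →
      m (Icc s b) = m (Icc s t) + m (Icc t b) := by
    intro m _ s t hst htb
    rw [← Icc_union_Ioc_eq_Icc hst htb, measure_union _ measurableSet_Ioc,
      measure_congr (Ioc_ae_eq_Icc (μ := m))]
    exact Set.disjoint_left.2 fun x hx hx' => absurd hx.2 (not_le.2 hx'.1)
  have key : ∀ k : ℕ, ∀ s, a ≤ s → s ≤ b → m₁ (Icc s b) ≤ (k + 1) * δ →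
      m₁ (Icc s b) ≤ m₂ (Icc s b) + δ := by
    intro k
    induction k with
    | zero =>
      intro s _ _ hs
      simp only [Nat.cast_zero, zero_add, one_mul] at hs
      exact hs.trans le_add_self
    | succ k ih =>
      intro s has hsb hs
      rcases le_or_gt (m₁ (Icc s b)) δ with hle | hlt
      · exact hle.trans le_add_self
      · have hc : Continuous fun t => ∫ _ in s..t, (1 : ℝ) ∂m₁ :=
          intervalIntegral.continuous_primitive (fun a b => by simp) s
        have hval : ∀ t, s ≤ t → ∫ _ in s..t, (1 : ℝ) ∂m₁ = (m₁ (Icc s t)).toReal := by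
          intro t hst
          rw [intervalIntegral.integral_of_le hst, ← measure_congr (μ := m₁) Ioc_ae_eq_Icc]
          simp [measureReal_def]
        have hmem : δ.toReal ∈ Icc (∫ _ in s..s, (1 : ℝ) ∂m₁) (∫ _ in s..b, (1 : ℝ) ∂m₁) := by
          rw [intervalIntegral.integral_same, hval b hsb]
          exact ⟨ENNReal.toReal_nonneg, ENNReal.toReal_mono (measure_ne_top _ _) hlt.le⟩
        -- Cut off an initial piece of `m₁`-measure exactly `δ`; its `m₂`-measure is at least `δ`.
        -- The last piece, of measure at most `δ`, is the error.
        obtain ⟨t, ⟨hst, htb⟩, ht⟩ := intermediate_value_Icc hsb hc.continuousOn hmem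
        simp only at ht
        rw [hval t hst, ENNReal.toReal_eq_toReal_iff' (measure_ne_top _ _) hδt] at ht
        have h2 := h s t has hst htb ht.ge
        have hsplit := hadd m₁ hst htb
        rw [ht] at hsplit
        have h3 : m₁ (Icc t b) ≤ (k + 1) * δ := by
          rw [hsplit] at hs
          push_cast at hs
          rw [add_mul ((k : ℝ≥0∞) + 1), one_mul, add_comm] at hs
          exact (ENNReal.add_le_add_iff_right hδt).1 hs
        calc m₁ (Icc s b) = δ + m₁ (Icc t b) := hsplit
          _ ≤ m₂ (Icc s t) + (m₂ (Icc t b) + δ) := add_le_add h2 (ih t (has.trans hst) htb h3)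
          _ = m₂ (Icc s b) + δ := by rw [hadd m₂ hst htb, add_assoc]
  obtain ⟨k, hk⟩ := ENNReal.exists_nat_mul_gt hδ0 (measure_ne_top m₁ (Icc a b))
  refine key k a le_rfl hab (hk.le.trans ?_)
  gcongr
  exact le_self_add

theorem Curve.sub_map {X Y : Type*} [TopologicalSpace X] [TopologicalSpace Y] (φ : C(X, Y))
    (γ : Curve X) {s t : ℝ} (hst : s ≤ t) :
    (γ.sub s t hst).map φ = (γ.map φ).sub s t hst := rfl

theorem Curve.IsRectifiable.sub_integral_eq_withDensity {X : Type*} [MetricSpace X]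
    [MeasurableSpace X] [BorelSpace X] {γ : Curve X} (hγ : γ.IsRectifiable) {ρ : X → ℝ≥0∞}
    (hρ : Measurable ρ) {s t : ℝ} (hs : γ.left ≤ s) (hst : s ≤ t) (ht : t ≤ γ.right) :
    (γ.sub s t hst).integral ρ =
      (γ.arcMeasure.withDensity fun x => ρ (γ.extend x)) (Icc s t) := by
  rw [hγ.sub_integral hρ hs hst ht, withDensity_apply _ measurableSet_Icc]

theorem Curve.IsRectifiable.integral_eq_withDensity {X : Type*} [MetricSpace X]
    [MeasurableSpace X] [BorelSpace X] {γ : Curve X} (hγ : γ.IsRectifiable) {ρ : X → ℝ≥0∞}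
    (hρ : Measurable ρ) :
    γ.integral ρ =
      (γ.arcMeasure.withDensity fun x => ρ (γ.extend x)) (Icc γ.left γ.right) := by
  rw [hγ.integral_eq hρ, withDensity_apply _ measurableSet_Icc]
  rw [Measure.restrict_eq_self_of_ae_mem (s := Icc γ.left γ.right)
    (mem_ae_iff.2 hγ.arcMeasure_compl)]

/-- The infimum defining the dilatation is attained for each family separately by division.
Vanishing modulus needs only some finite constant, and infinite modulus is excluded on account of `0
* ∞ = 0`. -/
theorem modulus_le_of_outerDilatation_le {X : Type u} [MetricSpace X] [MeasurableSpace X]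
    {Y : Type v} [MetricSpace Y] [MeasurableSpace Y] {μ : Measure X} {ν : Measure Y} {p : ℝ}
    {φ : C(X, Y)} {K : ℝ≥0} (h : outerDilatation p μ ν φ ≤ K) {Γ : Set (Curve X)}
    (hΓ : modulus p ν (Curve.map φ '' Γ) ≠ ∞) :
    modulus p μ Γ ≤ K * modulus p ν (Curve.map φ '' Γ) := by
  rcases eq_or_ne (modulus p ν (Curve.map φ '' Γ)) 0 with h0 | h0
  · have hlt : outerDilatation p μ ν φ < ∞ := h.trans_lt ENNReal.coe_lt_top
    simp only [outerDilatation, iInf_lt_iff] at hlt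
    obtain ⟨C, hC, -⟩ := hlt
    have := hC Γ
    rw [h0, mul_zero] at this ⊢
    exact this
  · rw [← ENNReal.div_le_iff h0 hΓ]
    refine le_trans ?_ h
    exact le_iInf₂ fun C hC => (ENNReal.div_le_iff h0 hΓ).2 (hC Γ)

section Dilatation

variable {X : Type u} [MetricSpace X] [MeasurableSpace X] [BorelSpace X]
  {Y : Type v} [MetricSpace Y] [MeasurableSpace Y] [BorelSpace Y]
  {μ : Measure X} {ν : Measure Y} {p : ℝ} {φ : C(X, Y)} {K : ℝ≥0}

/-- The images of the bad curves have modulus zero, since nonrectifiable curves impose no condition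
and the others have infinite `σ`-integral. The dilatation bound transfers this to the bad curves
themselves. -/
theorem exists_exceptional_map_of_outerDilatation_le {X : Type u} [MetricSpace X]
    [MeasurableSpace X] {Y : Type v} [MetricSpace Y] [MeasurableSpace Y] {μ : Measure X}
    {ν : Measure Y} {p : ℝ} {φ : C(X, Y)} {K : ℝ≥0} (hp : 0 < p)
    (hK : outerDilatation p μ ν φ ≤ K) {σ : Y → ℝ≥0∞} (hσ : Measurable σ)
    (hσp : ∫⁻ y, σ y ^ p ∂ν ≠ ∞) :
    ∃ τ : X → ℝ≥0∞, Measurable τ ∧ ∫⁻ x, τ x ^ p ∂μ ≠ ∞ ∧ ∀ γ : Curve X, γ.IsRectifiable →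
      γ.integral τ ≠ ∞ → (γ.map φ).IsRectifiable ∧ (γ.map φ).integral σ ≠ ∞ := by
  set Γ : Set (Curve X) := {γ | ¬((γ.map φ).IsRectifiable ∧ (γ.map φ).integral σ ≠ ∞)} with hΓ
  have h0 : modulus p ν (Curve.map φ '' Γ) = 0 := by
    refine (modulus_eq_zero_iff hp).2 ⟨σ, hσ, hσp, ?_⟩
    rintro _ ⟨γ, hγ, rfl⟩ hr
    by_contra hne
    exact hγ ⟨hr, hne⟩
  have h1 : modulus p μ Γ = 0 := by
    have := modulus_le_of_outerDilatation_le hK (Γ := Γ) (by simp [h0])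
    rw [h0, mul_zero] at this
    exact le_antisymm this zero_le
  obtain ⟨τ, hτ, hτp, h⟩ := (modulus_eq_zero_iff hp).1 h1
  refine ⟨τ, hτ, hτp, fun γ hr hfin => ?_⟩
  by_contra hγ
  exact hfin (h γ hγ hr)

/-- A bound on the outer dilatation provides, for a weight `σ` on the target, a weight on the
domain with controlled energy whose line integrals dominate those of `σ` along image curves. -/
theorem exists_integral_map_le (hp : 1 < p) (hK : outerDilatation p μ ν φ ≤ K)
    {σ : Y → ℝ≥0∞} (hσ : Measurable σ) (hσp : ∫⁻ y, σ y ^ p ∂ν ≠ ∞) {ε : ℝ≥0∞} (hε : ε ≠ 0)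
    (hεt : ε ≠ ∞) :
    ∃ g : X → ℝ≥0∞, Measurable g ∧ ∫⁻ x, g x ^ p ∂μ ≤ K * ∫⁻ y, σ y ^ p ∂ν + ε ∧
      ∃ τ : X → ℝ≥0∞, Measurable τ ∧ ∫⁻ x, τ x ^ p ∂μ ≠ ∞ ∧ ∀ γ : Curve X, γ.IsRectifiable →
        γ.integral τ ≠ ∞ → (γ.map φ).IsRectifiable ∧ γ.integral g ≠ ∞ ∧
          (γ.map φ).integral σ ≤ γ.integral g := by
  have hp0 : 0 < p := by linarith
  obtain ⟨τ₀, hτ₀, hτ₀p, hγ₀⟩ := exists_exceptional_map_of_outerDilatation_le hp0 hK hσ hσp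
  set I := ∫⁻ y, σ y ^ p ∂ν with hI
  have hB : K * I + ε ≠ ∞ := ENNReal.add_ne_top.2 ⟨ENNReal.mul_ne_top ENNReal.coe_ne_top hσp, hεt⟩
  -- Functions that dominate `σ` along image curves up to the error `2⁻ⁿ`. The condition is linear
  -- in `f`, so midpoints remain in the set.
  set C : ℕ → Set (X → ℝ≥0∞) := fun n => {f | Measurable f ∧ ∀ γ : Curve X, γ.IsRectifiable →
    γ.integral τ₀ ≠ ∞ → (γ.map φ).integral σ ≤ γ.integral f + 2⁻¹ ^ n} with hC
  have hanti : Antitone C := fun m n hmn f hf => ⟨hf.1, fun γ hr hfin =>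
    (hf.2 γ hr hfin).trans (add_le_add le_rfl
      (pow_le_pow_right_of_le_one' (ENNReal.inv_le_one.2 one_le_two) hmn))⟩
  have hmid : ∀ n, ∀ f ∈ C n, ∀ g ∈ C n, (fun x => (f x + g x) / 2) ∈ C n := by
    intro n f hf g hg
    refine ⟨(hf.1.add hg.1).div_const 2, fun γ hr hfin => ?_⟩
    have e : (γ.integral fun x => (f x + g x) / 2) = (γ.integral f + γ.integral g) / 2 := by
      have hm : Measurable γ.extend := γ.continuous_extend.measurable
      rw [hr.integral_eq (ρ := fun x => (f x + g x) / 2) ((hf.1.add hg.1).div_const 2),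
        hr.integral_eq hf.1, hr.integral_eq hg.1]
      simp only [div_eq_mul_inv]
      refine (lintegral_mul_const _ ((hf.1.comp hm).add (hg.1.comp hm))).trans ?_
      congr 1
      exact lintegral_add_left (hf.1.comp hm) _
    rw [e]
    set M := (γ.map φ).integral σ
    calc M = (M + M) / 2 := by
          rw [ENNReal.add_div, ENNReal.add_halves]
      _ ≤ ((γ.integral f + 2⁻¹ ^ n) + (γ.integral g + 2⁻¹ ^ n)) / 2 :=
          ENNReal.div_le_div_right (add_le_add (hf.2 γ hr hfin) (hg.2 γ hr hfin)) 2
      _ = (γ.integral f + γ.integral g) / 2 + 2⁻¹ ^ n := by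
          rw [add_add_add_comm, ENNReal.add_div, ENNReal.add_div (a := (2⁻¹ : ℝ≥0∞) ^ n),
            ENNReal.add_halves]
  have hne : ∀ n, ∃ f ∈ C n, ∫⁻ x, f x ^ p ∂μ ≤ K * I + ε := by
    intro n
    have hδ0 : (2⁻¹ : ℝ≥0∞) ^ n ≠ 0 := by simp
    have hδt : (2⁻¹ : ℝ≥0∞) ^ n ≠ ∞ := by simp
    set δ : ℝ≥0∞ := 2⁻¹ ^ n with hδ
    have hδi : δ⁻¹ ≠ ∞ := ENNReal.inv_ne_top.2 hδ0
    have hδp0 : δ ^ p ≠ 0 := (ENNReal.rpow_pos (pos_iff_ne_zero.2 hδ0) hδt).ne'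
    have hδpt : δ ^ p ≠ ∞ := ENNReal.rpow_ne_top_of_nonneg hp0.le hδt
    set Γ : Set (Curve X) := {γ | δ ≤ (γ.map φ).integral σ} with hΓ
    have hmodY : modulus p ν (Curve.map φ '' Γ) ≤ (δ ^ p)⁻¹ * I := by
      have hadm : IsAdmissible (Curve.map φ '' Γ) fun y => δ⁻¹ * σ y := by
        refine ⟨hσ.const_mul _, ?_⟩
        rintro _ ⟨γ, hγ, rfl⟩ _
        rw [Curve.integral_const_mul _ hδi, ← ENNReal.inv_mul_cancel hδ0 hδt]
        gcongr
        exact hγ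
      refine (iInf₂_le _ hadm).trans_eq ?_
      simp only [ENNReal.mul_rpow_of_nonneg _ _ hp0.le, ENNReal.inv_rpow]
      rw [lintegral_const_mul _ (hσ.pow_const p)]
    have hmodYt : modulus p ν (Curve.map φ '' Γ) ≠ ∞ :=
      ne_top_of_le_ne_top (ENNReal.mul_ne_top (ENNReal.inv_ne_top.2 hδp0) hσp) hmodY
    -- The slack `ε` makes the inequality strict, so that an admissible function with this energy
    -- exists.
    have hlt : modulus p μ Γ < (δ ^ p)⁻¹ * (K * I + ε) := by
      calc modulus p μ Γ ≤ K * ((δ ^ p)⁻¹ * I) :=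
            (modulus_le_of_outerDilatation_le hK hmodYt).trans (by gcongr)
        _ = (δ ^ p)⁻¹ * (K * I) := by ring
        _ < (δ ^ p)⁻¹ * (K * I + ε) :=
            ENNReal.mul_lt_mul_right (ENNReal.inv_ne_zero.2 hδpt) (ENNReal.inv_ne_top.2 hδp0)
              (ENNReal.lt_add_right (ENNReal.mul_ne_top ENNReal.coe_ne_top hσp) hε)
    simp only [modulus, iInf_lt_iff] at hlt
    obtain ⟨ρ, ⟨hρ, hadm⟩, hρp⟩ := hlt
    refine ⟨fun x => δ * ρ x, ⟨hρ.const_mul δ, fun γ hr hfin => ?_⟩, ?_⟩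
    · obtain ⟨hr', hfin'⟩ := hγ₀ γ hr hfin
      have := hr.nullSingletonClass_arcMeasure
      have := hr'.nullSingletonClass_arcMeasure
      have := isFiniteMeasure_withDensity_extend hr' hσ hfin'
      rw [hr'.integral_eq_withDensity hσ,
        hr.integral_eq_withDensity (ρ := fun x => δ * ρ x) (hρ.const_mul δ)]
      -- Every subcurve whose image has `σ`-integral at least `δ` belongs to `Γ`, so `δ * ρ`
      -- integrates to at least `δ` along it.
      refine measure_Icc_le_add γ.left_le_right hδ0 hδt fun s t hs hst ht hle => ?_
      rw [← hr'.sub_integral_eq_withDensity hσ hs hst ht, ← Curve.sub_map] at hle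
      rw [← hr.sub_integral_eq_withDensity (ρ := fun x => δ * ρ x) (hρ.const_mul δ) hs hst ht,
        Curve.integral_const_mul _ hδt]
      calc δ = δ * 1 := (mul_one δ).symm
        _ ≤ _ := by
          gcongr
          exact hadm _ hle (hr.sub hs hst ht)
    · simp only [ENNReal.mul_rpow_of_nonneg _ _ hp0.le]
      rw [lintegral_const_mul _ (hρ.pow_const p)]
      calc δ ^ p * ∫⁻ x, ρ x ^ p ∂μ ≤ δ ^ p * ((δ ^ p)⁻¹ * (K * I + ε)) := by gcongr
        _ = K * I + ε := by rw [← mul_assoc, ENNReal.mul_inv_cancel hδp0 hδpt, one_mul]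
  obtain ⟨f, hfC, hsup, hlim⟩ := exists_seq_lintegral_limsup_le μ hp C (fun n f hf => hf.1) hanti
    hmid hB hne
  have hfm : ∀ n, Measurable (f n) := fun n => (hfC n).1
  have hsm : Measurable fun x => ⨆ n, f n x := Measurable.iSup hfm
  obtain ⟨τ, hτ, hτp, hγ⟩ := exists_common_exceptional_two hτ₀ hsm hτ₀p hsup
  have hgm : Measurable fun x => limsup (fun n => f n x) atTop := Measurable.limsup hfm
  refine ⟨fun x => limsup (fun n => f n x) atTop, hgm, hlim, τ, hτ, hτp, fun γ hr hfin => ?_⟩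
  obtain ⟨hf₁, hf₂⟩ := hγ γ hfin
  refine ⟨(hγ₀ γ hr hf₁).1, ne_top_of_le_ne_top hf₂ (γ.integral_mono fun x => ?_), ?_⟩
  · exact limsup_le_iSup
  · have hm : Measurable γ.extend := γ.continuous_extend.measurable
    -- The reverse Fatou lemma along `γ`; the supremum of the sequence is an integrable majorant on
    -- almost every curve.
    have hrev : limsup (fun n => γ.integral (f n)) atTop ≤
        γ.integral fun x => limsup (fun n => f n x) atTop := by
      rw [hr.integral_eq hgm]
      rw [hr.integral_eq hsm] at hf₂
      simp only [fun n => hr.integral_eq (hfm n)]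
      exact limsup_lintegral_le (fun t => ⨆ n, f n (γ.extend t)) (fun n => (hfm n).comp hm)
        (fun n => Eventually.of_forall fun t => le_iSup (fun n => f n (γ.extend t)) n) hf₂
    refine le_trans ?_ hrev
    refine le_of_forall_gt_imp_ge_of_dense fun c hc => ?_
    have hev := eventually_lt_of_limsup_lt hc
    have hto : Tendsto (fun n : ℕ => c + (2⁻¹ : ℝ≥0∞) ^ n) atTop (𝓝 (c + 0)) :=
      tendsto_const_nhds.add (ENNReal.tendsto_pow_atTop_nhds_zero_of_lt_one (by simp))
    rw [add_zero] at hto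
    refine ge_of_tendsto hto ?_
    filter_upwards [hev] with n hn
    exact ((hfC n).2 γ hr hf₁).trans (by gcongr)

/-- Applied to the indicator of a set `E`, the previous lemma controls the arc length of image
curves inside `E`. -/
theorem exists_restrict_arcMeasure_map_le (hp : 1 < p) (hK : outerDilatation p μ ν φ ≤ K)
    {E : Set Y} (hE : MeasurableSet E) (hEt : ν E ≠ ∞) {ε : ℝ≥0∞} (hε : ε ≠ 0) (hεt : ε ≠ ∞) :
    ∃ g : X → ℝ≥0∞, Measurable g ∧ ∫⁻ x, g x ^ p ∂μ ≤ K * ν E + ε ∧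
      ∃ τ : X → ℝ≥0∞, Measurable τ ∧ ∫⁻ x, τ x ^ p ∂μ ≠ ∞ ∧ ∀ γ : Curve X, γ.IsRectifiable →
        γ.integral τ ≠ ∞ → (γ.map φ).IsRectifiable ∧
          (γ.map φ).arcMeasure.restrict ((γ.map φ).extend ⁻¹' E) ≤
            γ.arcMeasure.withDensity fun t => g (γ.extend t) := by
  have hp0 : 0 < p := by linarith
  have hσ : Measurable (E.indicator fun _ => (1 : ℝ≥0∞)) := measurable_const.indicator hE
  have hI : ∫⁻ y, (E.indicator (fun _ => (1 : ℝ≥0∞)) y) ^ p ∂ν = ν E := by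
    rw [← lintegral_indicator_one hE]
    refine lintegral_congr fun y => ?_
    by_cases hy : y ∈ E <;> simp [hy, ENNReal.zero_rpow_of_pos hp0]
  obtain ⟨g, hg, hgp, τ, hτ, hτp, hγ⟩ := exists_integral_map_le hp hK hσ (by rwa [hI]) hε hεt
  rw [hI] at hgp
  refine ⟨g, hg, hgp, τ, hτ, hτp, fun γ hr hfin => ?_⟩
  obtain ⟨hr', hgfin, -⟩ := hγ γ hr hfin
  refine ⟨hr', ?_⟩
  have := hr.nullSingletonClass_arcMeasure
  have := isFiniteMeasure_withDensity_extend hr hg hgfin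
  have hTm : MeasurableSet ((γ.map φ).extend ⁻¹' E) := (γ.map φ).continuous_extend.measurable hE
  have hres : (γ.map φ).arcMeasure.restrict ((γ.map φ).extend ⁻¹' E) =
      (γ.map φ).arcMeasure.withDensity
        fun t => E.indicator (fun _ => (1 : ℝ≥0∞)) ((γ.map φ).extend t) := by
    rw [← withDensity_indicator_one hTm]
    rfl
  -- The previous inequality holds for every subcurve of a good curve, hence on all intervals, hence
  -- between the measures.
  refine measure_le_of_Icc fun s t _ => ?_
  have hcompl : ((γ.map φ).arcMeasure.restrict ((γ.map φ).extend ⁻¹' E))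
      (Icc γ.left γ.right)ᶜ = 0 :=
    le_antisymm ((Measure.restrict_le_self _).trans_eq hr'.arcMeasure_compl) zero_le
  rw [← measure_inter_conull hcompl, Icc_inter_Icc]
  rcases le_or_gt (max s γ.left) (min t γ.right) with hle | hlt
  · have hs : γ.left ≤ max s γ.left := le_max_right _ _
    have ht : min t γ.right ≤ γ.right := min_le_right _ _
    rw [hres, ← hr'.sub_integral_eq_withDensity hσ hs hle ht, ← Curve.sub_map]
    refine ((hγ _ (hr.sub hs hle ht) (ne_top_of_le_ne_top hfin
      (hr.sub_integral_le hτ hs hle ht))).2.2).trans ?_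
    rw [hr.sub_integral_eq_withDensity hg hs hle ht]
    exact measure_mono (Icc_subset_Icc (le_max_left _ _) (min_le_left _ _))
  · rw [Icc_eq_empty (not_le.2 hlt)]; simp

end Dilatation

/-! ### From the dilatation bound to the energy bound -/

section Energy

variable {X : Type u} [MetricSpace X] [MeasurableSpace X] [BorelSpace X]
  {Y : Type v} [MetricSpace Y] [MeasurableSpace Y] [BorelSpace Y]
  {μ : Measure X} {ν : Measure Y} {p : ℝ} {φ : C(X, Y)} {K : ℝ≥0}

/-- The half-open annuli of integral radii around a point. -/
def annulus (y₀ : Y) (i : ℕ) : Set Y := {y | ⌊dist y y₀⌋₊ = i}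

theorem measurableSet_annulus (y₀ : Y) (i : ℕ) : MeasurableSet (annulus y₀ i) := by
  have : Measurable fun y : Y => ⌊dist y y₀⌋₊ :=
    Nat.measurable_floor.comp (continuous_id.dist continuous_const).measurable
  exact this (measurableSet_singleton i)

theorem isBounded_annulus {Y : Type*} [MetricSpace Y] (y₀ : Y) (i : ℕ) :
    Bornology.IsBounded (annulus y₀ i) := by
  refine (Metric.isBounded_ball (x := y₀) (r := i + 1)).subset fun y hy => ?_
  have hy' : ⌊dist y y₀⌋₊ = i := hy
  rw [Metric.mem_ball, ← hy']
  exact Nat.lt_floor_add_one _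

theorem pairwise_disjoint_annulus {Y : Type*} [MetricSpace Y] (y₀ : Y) :
    Pairwise (Function.onFun Disjoint (annulus y₀)) := fun i j hij =>
  Set.disjoint_left.2 fun y (hi : ⌊dist y y₀⌋₊ = i) (hj : ⌊dist y y₀⌋₊ = j) =>
    hij (hi.symm.trans hj)

theorem iUnion_annulus {Y : Type*} [MetricSpace Y] (y₀ : Y) : ⋃ i, annulus y₀ i = univ :=
  eq_univ_of_forall fun y => mem_iUnion.2 ⟨⌊dist y y₀⌋₊, rfl⟩

/-- The annuli have finite measure, so each carries a weight of finite energy controlling image arc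
length inside it. Disjointness lets these weights be glued; the result is only locally
`p`-integrable, as a bounded set meets finitely many annuli. -/
theorem UGloc_nonempty_of_outerDilatation_le (hν : IsBoundedlyFinite ν) (hp : 1 < p)
    (hK : outerDilatation p μ ν φ ≤ K) (y₀ : Y) : (UGloc p μ φ).Nonempty := by
  have hp0 : 0 < p := by linarith
  have hφ : Measurable φ := φ.continuous.measurable
  choose g hg hgp τ hτ hτp hγ using fun i => exists_restrict_arcMeasure_map_le hp hK
    (measurableSet_annulus y₀ i) (hν _ (isBounded_annulus y₀ i)).ne one_ne_zero ENNReal.one_ne_top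
  obtain ⟨σ, hσ, hσp, hσγ⟩ := exists_common_exceptional hp0 τ hτ hτp
  have hAm : ∀ i, MeasurableSet (φ ⁻¹' annulus y₀ i) := fun i => hφ (measurableSet_annulus y₀ i)
  have hm : ∀ i, Measurable ((φ ⁻¹' annulus y₀ i).indicator (g i)) := fun i =>
    (hg i).indicator (hAm i)
  set ρ : X → ℝ≥0∞ := fun x => ⨆ i, (φ ⁻¹' annulus y₀ i).indicator (g i) x with hρ
  have hρm : Measurable ρ := Measurable.iSup hm
  refine ⟨ρ, (isWeakUpperGradient_iff hp0).2 ⟨hρm, σ, hσ, hσp, fun γ hr hfin => ?_⟩, fun x => ?_⟩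
  · have hr' : (γ.map φ).IsRectifiable := (hγ 0 γ hr (hσγ γ hfin 0)).1
    set T : ℕ → Set ℝ := fun i => (γ.map φ).extend ⁻¹' annulus y₀ i with hT
    have hTm : ∀ i, MeasurableSet (T i) := fun i =>
      (γ.map φ).continuous_extend.measurable (measurableSet_annulus y₀ i)
    have hTd : Pairwise (Function.onFun Disjoint T) := fun i j hij =>
      (pairwise_disjoint_annulus y₀ hij).preimage _
    have hTu : ⋃ i, T i = univ := by
      rw [hT, ← preimage_iUnion, iUnion_annulus, preimage_univ]
    have hpiece : ∀ i, (γ.map φ).arcMeasure (T i) ≤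
        (γ.arcMeasure.withDensity fun t => ρ (γ.extend t)) (T i) := by
      intro i
      have := (hγ i γ hr (hσγ γ hfin i)).2 (T i)
      rw [Measure.restrict_apply_self, withDensity_apply _ (hTm i)] at this
      refine this.trans ?_
      rw [withDensity_apply _ (hTm i)]
      refine setLIntegral_mono' (hTm i) fun t ht => ?_
      refine le_trans ?_ (le_iSup (fun i => (φ ⁻¹' annulus y₀ i).indicator (g i) (γ.extend t)) i)
      have hmem : γ.extend t ∈ φ ⁻¹' annulus y₀ i := ht
      rw [indicator_of_mem hmem]
    calc edist (φ (γ.extend γ.left)) (φ (γ.extend γ.right))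
        ≤ (γ.map φ).arcMeasure univ := Curve.edist_le_arcMeasure hr'
      _ = ∑' i, (γ.map φ).arcMeasure (T i) := by rw [← hTu, measure_iUnion hTd hTm]
      _ ≤ ∑' i, (γ.arcMeasure.withDensity fun t => ρ (γ.extend t)) (T i) :=
          ENNReal.tsum_le_tsum hpiece
      _ = (γ.arcMeasure.withDensity fun t => ρ (γ.extend t)) univ := by
          rw [← hTu, measure_iUnion hTd hTm]
      _ = γ.integral ρ := by
          rw [hr.integral_eq hρm, withDensity_apply _ MeasurableSet.univ, Measure.restrict_univ]
  · refine ⟨φ ⁻¹' Metric.ball (φ x) 1, Metric.isOpen_ball.preimage φ.continuous,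
      Metric.mem_ball_self one_pos, ?_⟩
    obtain ⟨N, hN⟩ := exists_nat_gt (dist (φ x) y₀ + 1)
    refine (lintegral_iSup_rpow_le_tsum _ hp0 _ hm).trans_lt ?_
    rw [tsum_eq_sum (s := Finset.range N) fun i hi => ?_]
    · refine ENNReal.sum_lt_top.2 fun i _ => ?_
      refine lt_of_le_of_lt (setLIntegral_le_lintegral _ _) (lt_of_le_of_lt
        (lintegral_mono fun z => ?_) ((hgp i).trans_lt (ENNReal.add_lt_top.2
          ⟨ENNReal.mul_lt_top ENNReal.coe_lt_top (hν _ (isBounded_annulus y₀ i)),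
            ENNReal.one_lt_top⟩)))
      gcongr
      exact indicator_le_self _ _ _
    · rw [setLIntegral_congr_fun (g := fun _ => 0)
        (Metric.isOpen_ball.preimage φ.continuous).measurableSet fun z hz => ?_, lintegral_zero]
      have hz' : z ∉ φ ⁻¹' annulus y₀ i := by
        intro hmem
        have h1 : ⌊dist (φ z) y₀⌋₊ = i := hmem
        have h2 : dist (φ z) (φ x) < 1 := hz
        have h3 : dist (φ z) y₀ < N := by linarith [dist_triangle (φ z) (φ x) y₀]
        rw [Finset.mem_range, not_lt, ← h1] at hi
        exact absurd (Nat.floor_lt dist_nonneg |>.2 h3) (not_lt.2 hi)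
      simp only [indicator_of_notMem hz', ENNReal.zero_rpow_of_pos hp0]

/-- Replacing `ρ` on `φ⁻¹E` by the weight `g` belonging to `E` gives another weak upper gradient, so
minimality forces `ρ ≤ g` there, and the energy of `g` is at most `K ν(E) + ε`. -/
theorem lintegral_preimage_le_of_outerDilatation_le [SecondCountableTopology X]
    (hp : 1 < p)
    (hK : outerDilatation p μ ν φ ≤ K) {ρ : X → ℝ≥0∞} (hρ : IsMinimalUpperGradient p μ φ ρ)
    {E : Set Y} (hE : MeasurableSet E) (hEt : ν E ≠ ∞) :
    ∫⁻ x in φ ⁻¹' E, ρ x ^ p ∂μ ≤ K * ν E := by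
  classical
  have hp0 : 0 < p := by linarith
  have hφ : Measurable φ := φ.continuous.measurable
  have hρm : Measurable ρ := hρ.1.1.1
  refine ENNReal.le_of_forall_pos_le_add fun ε hε _ => ?_
  obtain ⟨g, hg, hgp, τ, hτ, hτp, hγ⟩ := exists_restrict_arcMeasure_map_le (μ := μ) hp hK hE hEt
    (ε := ε) (by exact_mod_cast hε.ne') ENNReal.coe_ne_top
  obtain ⟨τ', hτ', hτp', hγ'⟩ := exists_exceptional_map hp0 hρ.1
  obtain ⟨σ, hσ, hσp, hσγ⟩ := exists_common_exceptional_two hτ hτ' hτp hτp'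
  have hEm : MeasurableSet (φ ⁻¹' E) := hφ hE
  set F : X → ℝ≥0∞ := (φ ⁻¹' E).piecewise g ρ with hF
  have hFm : Measurable F := hg.piecewise hEm hρm
  have hFmem : F ∈ UGloc p μ φ := by
    refine ⟨(isWeakUpperGradient_iff hp0).2 ⟨hFm, σ, hσ, hσp, fun γ hr hfin => ?_⟩, fun x => ?_⟩
    · obtain ⟨hr', h1⟩ := hγ γ hr (hσγ γ hfin).1
      obtain ⟨-, h2⟩ := hγ' γ hr (hσγ γ hfin).2
      have hA : MeasurableSet ((γ.map φ).extend ⁻¹' E) :=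
        (γ.map φ).continuous_extend.measurable hE
      have hle : (γ.map φ).arcMeasure ≤ γ.arcMeasure.withDensity fun t => F (γ.extend t) := by
        refine le_withDensity_piecewise hA h1 (Measure.restrict_le_self.trans h2) _
          (fun t ht => ?_) fun t ht => ?_
        · have : γ.extend t ∈ φ ⁻¹' E := ht
          rw [hF, piecewise_eq_of_mem _ _ _ this]
        · have : γ.extend t ∉ φ ⁻¹' E := ht
          rw [hF, piecewise_eq_of_notMem _ _ _ this]
      calc edist (φ (γ.extend γ.left)) (φ (γ.extend γ.right))
          ≤ (γ.map φ).arcMeasure univ := Curve.edist_le_arcMeasure hr'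
        _ ≤ (γ.arcMeasure.withDensity fun t => F (γ.extend t)) univ := hle univ
        _ = γ.integral F := by
          rw [hr.integral_eq hFm, withDensity_apply _ MeasurableSet.univ, Measure.restrict_univ]
    · obtain ⟨U, hU, hx, hlt⟩ := hρ.1.2 x
      refine ⟨U, hU, hx, ?_⟩
      have hgU : ∫⁻ y in U, g y ^ p ∂μ < ∞ := (setLIntegral_le_lintegral _ _).trans_lt
        (hgp.trans_lt (ENNReal.add_lt_top.2
          ⟨ENNReal.mul_lt_top ENNReal.coe_lt_top hEt.lt_top, ENNReal.coe_lt_top⟩))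
      refine lt_of_le_of_lt (lintegral_mono fun y => ?_)
        ((lintegral_sup_rpow_le (p := p) (g := ρ) hg).trans_lt (ENNReal.add_lt_top.2 ⟨hgU, hlt⟩))
      gcongr
      by_cases hy : y ∈ φ ⁻¹' E
      · rw [hF, piecewise_eq_of_mem _ _ _ hy]; exact le_sup_left
      · rw [hF, piecewise_eq_of_notMem _ _ _ hy]; exact le_sup_right
  calc ∫⁻ x in φ ⁻¹' E, ρ x ^ p ∂μ ≤ ∫⁻ x in φ ⁻¹' E, g x ^ p ∂μ := by
        refine lintegral_mono_ae ?_
        filter_upwards [ae_restrict_of_ae (hρ.2 F hFmem), ae_restrict_mem hEm] with x hx hxE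
        rw [hF, piecewise_eq_of_mem _ _ _ hxE] at hx
        gcongr
    _ ≤ ∫⁻ x, g x ^ p ∂μ := setLIntegral_le_lintegral _ _
    _ ≤ _ := hgp

theorem exists_mem_UGloc_of_outerDilatation_le [SecondCountableTopology X]
    (hν : IsBoundedlyFinite ν) (hp : 1 < p)
    (hK : outerDilatation p μ ν φ ≤ K) (y₀ : Y) : ∃ ρ ∈ UGloc p μ φ,
      ∀ E : Set Y, MeasurableSet E → ∫⁻ x in φ ⁻¹' E, ρ x ^ p ∂μ ≤ K * ν E := by
  have hφ : Measurable φ := φ.continuous.measurable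
  obtain ⟨ρ, hρ⟩ := exists_isMinimalUpperGradient (by linarith)
    (UGloc_nonempty_of_outerDilatation_le hν hp hK y₀)
  refine ⟨ρ, hρ.1, fun E hE => ?_⟩
  have hEi : ∀ i, MeasurableSet (E ∩ annulus y₀ i) := fun i => hE.inter (measurableSet_annulus y₀ i)
  have hdisj : Pairwise (Function.onFun Disjoint fun i => E ∩ annulus y₀ i) := fun i j hij =>
    (pairwise_disjoint_annulus y₀ hij).mono inter_subset_right inter_subset_right
  have hEu : E = ⋃ i, E ∩ annulus y₀ i := by
    rw [← inter_iUnion, iUnion_annulus, inter_univ]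
  calc ∫⁻ x in φ ⁻¹' E, ρ x ^ p ∂μ
      = ∑' i, ∫⁻ x in φ ⁻¹' (E ∩ annulus y₀ i), ρ x ^ p ∂μ := by
        conv_lhs => rw [hEu, preimage_iUnion]
        exact lintegral_iUnion (fun i => hφ (hEi i)) (fun i j hij => (hdisj hij).preimage _) _
    _ ≤ ∑' i, K * ν (E ∩ annulus y₀ i) := ENNReal.tsum_le_tsum fun i =>
        lintegral_preimage_le_of_outerDilatation_le hp hK hρ (hEi i)
          ((measure_mono inter_subset_right).trans_lt (hν _ (isBounded_annulus y₀ i))).ne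
    _ = K * ν E := by
        rw [ENNReal.tsum_mul_left, ← measure_iUnion hdisj hEi, ← hEu]

end Energy

/-! ### From the pull-back property to the energy bound -/

section PullBack

variable {X : Type u} [MetricSpace X] [MeasurableSpace X] [BorelSpace X]
  {Y : Type v} [MetricSpace Y] [MeasurableSpace Y] [BorelSpace Y] [SecondCountableTopology Y]
  {μ : Measure X} {ν : Measure Y} {p : ℝ} {φ : C(X, Y)} {K : ℝ≥0}

/-- Restriction of weak upper gradients to a smaller subset. -/
theorem comp_inclusion_mem_UGloc {Z : Type*} [MetricSpace Z] (hp : 0 < p) {s t : Set X}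
    (hs : MeasurableSet s) (ht : MeasurableSet t) (hst : s ⊆ t) {h : t → Z} {g : t → ℝ≥0∞}
    (hg : g ∈ UGloc p (subspaceMeasure μ t) h) :
    g ∘ inclusion hst ∈ UGloc p (subspaceMeasure μ s) (h ∘ inclusion hst) := by
  have him : Measurable (inclusion hst) := (continuous_inclusion hst).measurable
  have hle : (subspaceMeasure μ s).map (inclusion hst) ≤ subspaceMeasure μ t := by
    refine Measure.le_iff.2 fun E hE => ?_
    rw [Measure.map_apply him hE, subspaceMeasure, subspaceMeasure,
      comap_subtype_coe_apply hs, comap_subtype_coe_apply ht]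
    refine measure_mono ?_
    rintro _ ⟨x, hx, rfl⟩
    exact ⟨inclusion hst x, hx, rfl⟩
  have hint : ∀ (U : Set t) (f : t → ℝ≥0∞), MeasurableSet U → Measurable f →
      ∫⁻ x in inclusion hst ⁻¹' U, f (inclusion hst x) ∂subspaceMeasure μ s ≤
        ∫⁻ x in U, f x ∂subspaceMeasure μ t := by
    intro U f hU hf
    rw [← setLIntegral_map hU hf him]
    exact lintegral_mono' (Measure.restrict_mono le_rfl hle) le_rfl
  let i : C(s, t) := ⟨inclusion hst, continuous_inclusion hst⟩
  have hi : Isometry i := fun x y => rfl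
  obtain ⟨hgm, τ, hτ, hτp, hγ⟩ := (isWeakUpperGradient_iff hp).1 hg.1
  refine ⟨(isWeakUpperGradient_iff hp).2 ⟨hgm.comp him, τ ∘ inclusion hst, hτ.comp him, ?_,
    fun γ hr hfin => ?_⟩, fun x => ?_⟩
  · have := hint univ (fun x => τ x ^ p) MeasurableSet.univ (hτ.pow_const p)
    rw [preimage_univ, Measure.restrict_univ, Measure.restrict_univ] at this
    exact ne_top_of_le_ne_top hτp this
  · have hr' : (γ.map i).IsRectifiable := by
      rwa [Curve.IsRectifiable, Curve.map_length_of_isometry hi]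
    have := hγ (γ.map i) hr' (by rwa [Curve.map_integral_of_isometry hi])
    rwa [Curve.map_integral_of_isometry hi] at this
  · obtain ⟨U, hU, hx, hlt⟩ := hg.2 (inclusion hst x)
    exact ⟨inclusion hst ⁻¹' U, hU.preimage (continuous_inclusion hst), hx,
      (hint U (fun x => g x ^ p) hU.measurableSet (hgm.pow_const p)).trans_lt hlt⟩

/-- An isometric embedding of a separable metric space into a space of any universe. -/
theorem exists_isometry_ulift (Y : Type v) [MetricSpace Y] [TopologicalSpace.SeparableSpace Y] :
    ∃ (Z : Type w) (_ : MetricSpace Z) (e : Y → Z), Isometry e :=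
  ⟨_, inferInstance, fun y => ULift.up.{w} (kuratowskiEmbedding Y y), fun x y =>
    (kuratowskiEmbedding.isometry Y x y : _)⟩

theorem memDirichlet_of_isometry {Z : Type w} [MetricSpace Z] {e : Y → Z} (he : Isometry e)
    (hp : 0 < p) {Ω : Set Y} (hΩ : MeasurableSet Ω) (hΩt : ν Ω ≠ ∞) :
    (fun _ => 1) ∈ UG p (subspaceMeasure ν Ω) (fun y : Ω => e y) ∧
      MemDirichlet p (subspaceMeasure ν Ω) (fun y : Ω => e y) := by
  have hc : Continuous fun y : Ω => e y := he.continuous.comp continuous_subtype_val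
  have hUG : (fun _ => 1) ∈ UG p (subspaceMeasure ν Ω) (fun y : Ω => e y) := by
    refine ⟨(isWeakUpperGradient_iff hp).2 ⟨measurable_const, fun _ => 0, measurable_const, ?_,
      fun γ hr _ => ?_⟩, ?_⟩
    · simp [ENNReal.zero_rpow_of_pos hp]
    · rw [he.edist_eq]
      refine (Curve.edist_le_arcMeasure hr).trans_eq ?_
      rw [hr.integral_eq (ρ := fun _ => 1) measurable_const, lintegral_const, one_mul]
    · simp only [ENNReal.one_rpow]
      rw [lintegral_subspaceMeasure hΩ fun _ => 1]
      simpa using hΩt.lt_top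
  refine ⟨hUG, ⟨⟨∅, measure_empty, ?_⟩, fun U hU =>
    (hU.preimage hc).measurableSet.nullMeasurableSet⟩, _, hUG⟩
  rw [compl_empty, image_univ]
  exact TopologicalSpace.isSeparable_range hc

/-- The test map is the isometric embedding, whose minimal upper gradient is at most `1`. Choosing
the indicator of `E` as the weight turns the pull-back inequality into the energy bound. -/
theorem exists_energy_le_of_pullsBackDirichlet (hp : 0 < p) {Ω : Set Y} (hΩ : MeasurableSet Ω)
    (hΩt : ν Ω ≠ ∞) (h : PullsBackDirichlet.{u, v, w} p μ ν φ K Ω) {Z : Type w} [MetricSpace Z]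
    {e : Y → Z} (he : Isometry e) :
    ∃ r : φ ⁻¹' Ω → ℝ≥0∞,
      IsMinimalUpperGradient p (subspaceMeasure μ (φ ⁻¹' Ω)) (fun x => e (φ x)) r ∧
      ∀ R : X → ℝ≥0∞, (∀ x : φ ⁻¹' Ω, R x = r x) → (∀ x ∉ φ ⁻¹' Ω, R x = 0) →
        ∀ E : Set Y, MeasurableSet E → ∫⁻ x in φ ⁻¹' E, R x ^ p ∂μ ≤ K * ν E := by
  obtain ⟨hUG, hD⟩ := memDirichlet_of_isometry (ν := ν) he hp hΩ hΩt
  obtain ⟨-, -, r₁, r, hr₁, hr, hle⟩ := h Z _ hD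
  refine ⟨r, hr, fun R hRr hR0 E hE => ?_⟩
  have hφ : Measurable φ := φ.continuous.measurable
  have hEm : MeasurableSet (Subtype.val ⁻¹' E : Set Ω) := measurable_subtype_coe hE
  have hbound : ∫⁻ y, (Subtype.val ⁻¹' E : Set Ω).indicator 1 y * r₁ y ^ p ∂subspaceMeasure ν Ω ≤
      ν (E ∩ Ω) := by
    calc _ ≤ ∫⁻ y, (Subtype.val ⁻¹' E : Set Ω).indicator 1 y ∂subspaceMeasure ν Ω := by
          refine lintegral_mono_ae ?_
          filter_upwards [hr₁.2 _ (UG_subset_UGloc hUG)] with y hy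
          calc _ ≤ (Subtype.val ⁻¹' E : Set Ω).indicator 1 y * (1 : ℝ≥0∞) ^ p := by gcongr
            _ = _ := by rw [ENNReal.one_rpow, mul_one]
      _ = ν (E ∩ Ω) := by
          rw [lintegral_indicator_one hEm, subspaceMeasure, comap_subtype_coe_apply hΩ,
            Subtype.image_preimage_coe, inter_comm]
  have hmeas : Measurable fun y => (Subtype.val ⁻¹' E : Set Ω).indicator 1 y * r₁ y ^ p :=
    (measurable_one.indicator hEm).mul (hr₁.1.1.1.pow_const p)
  have h1 := hle ((Subtype.val ⁻¹' E : Set Ω).indicator 1) hmeas (hbound.trans_lt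
    ((measure_mono inter_subset_right).trans_lt hΩt.lt_top))
  calc ∫⁻ x in φ ⁻¹' E, R x ^ p ∂μ
      = ∫⁻ x, (φ ⁻¹' E).indicator (fun x => R x ^ p) x ∂μ :=
        (lintegral_indicator (hφ hE) _).symm
    _ = ∫⁻ x, (Subtype.val ⁻¹' E : Set Ω).indicator 1 (Ω.restrictPreimage φ x) * r x ^ p
          ∂subspaceMeasure μ (φ ⁻¹' Ω) := by
        refine lintegral_eq_lintegral_subspaceMeasure (hφ hΩ) (fun x => ?_) fun x hx => ?_
        · by_cases hxE : φ x ∈ E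
          · have h2 : Ω.restrictPreimage φ x ∈ (Subtype.val ⁻¹' E : Set Ω) := hxE
            have h3 : (x : X) ∈ φ ⁻¹' E := hxE
            rw [indicator_of_mem h2, indicator_of_mem h3, hRr, Pi.one_apply, one_mul]
          · have h2 : Ω.restrictPreimage φ x ∉ (Subtype.val ⁻¹' E : Set Ω) := hxE
            have h3 : (x : X) ∉ φ ⁻¹' E := hxE
            rw [indicator_of_notMem h2, indicator_of_notMem h3, zero_mul]
        · simp [indicator, hR0 x hx, ENNReal.zero_rpow_of_pos hp]
    _ ≤ K * ν (E ∩ Ω) := h1.trans (by gcongr)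
    _ ≤ K * ν E := by gcongr; exact inter_subset_left

theorem exists_mem_UGloc_of_pullsBackDirichlet [SecondCountableTopology X]
    (hν : IsBoundedlyFinite ν) (hp : 0 < p)
    {Ω : ℕ → Set Y} (hΩ : ∀ n, MeasurableSet (Ω n)) (hΩt : ∀ n, ν (Ω n) ≠ ∞) (hmono : Monotone Ω)
    (hex : ∀ B : Set Y, Bornology.IsBounded B → ∃ n, B ⊆ Ω n)
    (h : ∀ n, PullsBackDirichlet.{u, v, w} p μ ν φ K (Ω n)) :
    ∃ ρ ∈ UGloc p μ φ,
      ∀ E : Set Y, MeasurableSet E → ∫⁻ x in φ ⁻¹' E, ρ x ^ p ∂μ ≤ K * ν E := by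
  have hφ : Measurable φ := φ.continuous.measurable
  have hΩ' : ∀ n, MeasurableSet (φ ⁻¹' Ω n) := fun n => hφ (hΩ n)
  obtain ⟨Z, _, e, he⟩ := exists_isometry_ulift.{v, w} Y
  choose r hr hE using fun n =>
    exists_energy_le_of_pullsBackDirichlet (μ := μ) hp (hΩ n) (hΩt n) (h n) he
  choose R hR hRr hR0 using fun n => exists_measurable_extension_by_zero (hΩ' n) (hr n).1.1.1
  -- The restriction of the gradient on the larger set is a weak upper gradient on the smaller one,
  -- where `r n` is minimal.
  have hRmono : ∀ n, ∀ᵐ x ∂μ, R n x ≤ R (n + 1) x := by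
    intro n
    have hst : φ ⁻¹' Ω n ⊆ φ ⁻¹' Ω (n + 1) := preimage_mono (hmono n.le_succ)
    have h1 := (hr n).2 _ (comp_inclusion_mem_UGloc hp (hΩ' n) (hΩ' (n + 1)) hst (hr (n + 1)).1)
    have h2 : ∀ᵐ x ∂μ.restrict (φ ⁻¹' Ω n), R n x ≤ R (n + 1) x := by
      rw [← map_comap_subtype_coe (hΩ' n), (MeasurableEmbedding.subtype_coe (hΩ' n)).ae_map_iff]
      filter_upwards [h1] with x hx
      rw [hRr n x]
      exact hx.trans_eq (hRr (n + 1) (inclusion hst x)).symm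
    filter_upwards [(ae_restrict_iff' (hΩ' n)).1 h2] with x hx
    by_cases hxn : x ∈ φ ⁻¹' Ω n
    · exact hx hxn
    · rw [hR0 n x hxn]; exact zero_le
  set ρ : X → ℝ≥0∞ := fun x => ⨆ n, R n x with hρ
  have hρm : Measurable ρ := Measurable.iSup hR
  have henergy : ∀ E : Set Y, MeasurableSet E → ∫⁻ x in φ ⁻¹' E, ρ x ^ p ∂μ ≤ K * ν E := by
    intro E hEm
    have e1 : ∀ x, ρ x ^ p = ⨆ n, R n x ^ p := fun x =>
      (ENNReal.orderIsoRpow p hp).map_iSup _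
    simp only [e1]
    rw [lintegral_iSup_ae (fun n => (hR n).pow_const p) fun n => ?_]
    · exact iSup_le fun n => hE n (R n) (hRr n) (hR0 n) E hEm
    · filter_upwards [ae_restrict_of_ae (hRmono n)] with x hx
      gcongr
  refine ⟨ρ, ⟨(isWeakUpperGradient_iff hp).2 ⟨hρm, ?_⟩, fun x => ?_⟩, henergy⟩
  · choose hrm τ hτ hτp hγ using fun n => (isWeakUpperGradient_iff hp).1 (hr n).1.1
    choose T hT hTτ hT0 using fun n => exists_measurable_extension_by_zero (hΩ' n) (hτ n)
    obtain ⟨σ, hσ, hσp, hσγ⟩ := exists_common_exceptional (μ := μ) hp T hT fun n => by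
      rw [lintegral_rpow_eq_lintegral_subspaceMeasure hp (hΩ' n) (hTτ n) (hT0 n)]
      exact hτp n
    refine ⟨σ, hσ, hσp, fun γ hγr hfin => ?_⟩
    -- The image of a curve is compact, so the curve lies in a single `φ⁻¹(Ω n)` and one of the
    -- gradients `r n` applies to all of it.
    have hb : Bornology.IsBounded (range (φ ∘ γ.path)) :=
      (isCompact_range (φ.continuous.comp γ.path.continuous)).isBounded
    obtain ⟨n, hn⟩ := hex _ hb
    obtain ⟨γ', hγ'⟩ := Curve.exists_lift (s := φ ⁻¹' Ω n) γ fun t => hn ⟨t, rfl⟩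
    have hr' : γ'.IsRectifiable := by
      rw [← Curve.isRectifiable_map_inclusionMap, hγ']; exact hγr
    have hfin' : γ'.integral (τ n) ≠ ∞ := by
      rw [← Curve.map_inclusionMap_integral (hTτ n), hγ']; exact hσγ γ hfin n
    have h1 := hγ n γ' hr' hfin'
    rw [← Curve.map_inclusionMap_integral (hRr n), hγ', he.edist_eq] at h1
    subst hγ'
    exact h1.trans (Curve.integral_mono _ fun x => le_iSup (fun n => R n x) n)
  · refine ⟨φ ⁻¹' Metric.ball (φ x) 1, Metric.isOpen_ball.preimage φ.continuous,
      Metric.mem_ball_self one_pos, (henergy _ Metric.isOpen_ball.measurableSet).trans_lt ?_⟩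
    exact ENNReal.mul_lt_top ENNReal.coe_lt_top (hν _ Metric.isBounded_ball)

end PullBack

end MetricSobolev

/-! ### The equivalence -/

open MetricSobolev in
theorem proposition2p14
    {X : Type u} [MetricSpace X] [CompleteSpace X] [TopologicalSpace.SeparableSpace X]
    [MeasurableSpace X] [BorelSpace X]
    {Y : Type v} [MetricSpace Y] [CompleteSpace Y] [TopologicalSpace.SeparableSpace Y]
    [MeasurableSpace Y] [BorelSpace Y]
    (μ : Measure X) (hμ : MetricSobolev.IsBoundedlyFinite μ)
    (ν : Measure Y) (hν : MetricSobolev.IsBoundedlyFinite ν)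
    (p : ℝ) (hp : 1 < p) (K : ℝ≥0) (φ : C(X, Y)) :
    List.TFAE [
      MetricSobolev.outerDilatation p μ ν φ ≤ (K : ℝ≥0∞),
      ∀ Ω : Set Y, IsOpen Ω → MetricSobolev.PullsBackDirichlet.{u, v, w} p μ ν φ K Ω,
      ∀ Ω : Set Y, IsClosed Ω → ν Ω < ∞ →
        MetricSobolev.PullsBackDirichlet.{u, v, w} p μ ν φ K Ω,
      MetricSobolev.MemDirichletLoc p μ φ ∧
        ∃ ρ : X → ℝ≥0∞, MetricSobolev.IsMinimalUpperGradient p μ φ ρ ∧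
          ∀ E : Set Y, MeasurableSet E → ∫⁻ x in φ ⁻¹' E, ρ x ^ p ∂μ ≤ K * ν E] := by
  have hp0 : 0 < p := by linarith
  have := UniformSpace.secondCountable_of_separable X
  have := UniformSpace.secondCountable_of_separable Y
  tfae_have 1 → 4 := fun h => by
    have hρ : ∃ ρ ∈ UGloc p μ φ,
        ∀ E : Set Y, MeasurableSet E → ∫⁻ x in φ ⁻¹' E, ρ x ^ p ∂μ ≤ K * ν E := by
      -- Annuli and balls need a centre, so an empty target, which forces an empty domain, is
      -- treated apart.
      rcases isEmpty_or_nonempty Y with hY | ⟨⟨y₀⟩⟩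
      · have : IsEmpty X := φ.toFun.isEmpty
        exact ⟨0, ⟨⟨measurable_const, ∅, (modulus_eq_zero_iff hp0).2 ⟨0, measurable_const,
          by simp, by simp⟩, fun γ => isEmptyElim (γ.extend γ.left)⟩, isEmptyElim⟩,
          fun E _ => by simp⟩
      · exact exists_mem_UGloc_of_outerDilatation_le hν hp h y₀
    obtain ⟨ρ, hρ, hE⟩ := hρ
    exact exists_minimal_of_mem_UGloc hp0 hρ hE
  tfae_have 4 → 1 := fun ⟨_, ρ, hρ, hE⟩ => outerDilatation_le hp0 hρ.1 hE
  tfae_have 4 → 2 := fun ⟨_, ρ, hρ, hE⟩ Ω hΩ => pullsBackDirichlet hp0 hρ.1 hE hΩ.measurableSet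
  tfae_have 4 → 3 := fun ⟨_, ρ, hρ, hE⟩ Ω hΩ _ => pullsBackDirichlet hp0 hρ.1 hE hΩ.measurableSet
  -- Open and closed sets are tested only through an exhaustion: open balls in one case, closed
  -- balls in the other, both of finite measure.
  have key : ∀ {Ω : ℕ → Set Y}, (∀ n, MeasurableSet (Ω n)) → (∀ n, ν (Ω n) ≠ ∞) → Monotone Ω →
      (∀ B : Set Y, Bornology.IsBounded B → ∃ n, B ⊆ Ω n) →
      (∀ n, PullsBackDirichlet.{u, v, w} p μ ν φ K (Ω n)) →
      MemDirichletLoc p μ φ ∧ ∃ ρ : X → ℝ≥0∞, IsMinimalUpperGradient p μ φ ρ ∧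
        ∀ E : Set Y, MeasurableSet E → ∫⁻ x in φ ⁻¹' E, ρ x ^ p ∂μ ≤ K * ν E := by
    intro Ω h1 h2 h3 h4 h5
    obtain ⟨ρ, hρ, hE⟩ := exists_mem_UGloc_of_pullsBackDirichlet hν hp0 h1 h2 h3 h4 h5
    exact exists_minimal_of_mem_UGloc hp0 hρ hE
  have hempty : ∀ [IsEmpty Y] (B : Set Y), B ⊆ ∅ := fun B y => isEmptyElim y
  tfae_have 2 → 4 := fun h => by
    rcases isEmpty_or_nonempty Y with hY | ⟨⟨y₀⟩⟩
    · exact key (Ω := fun _ => ∅) (by simp) (by simp) monotone_const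
        (fun B _ => ⟨0, hempty B⟩) fun _ => h _ isOpen_empty
    · refine key (Ω := fun n : ℕ => Metric.ball y₀ n) (fun n => measurableSet_ball)
        (fun n => (hν _ Metric.isBounded_ball).ne)
        (fun m n hmn => Metric.ball_subset_ball (by exact_mod_cast hmn)) (fun B hB => ?_)
        fun n => h _ Metric.isOpen_ball
      obtain ⟨c, hc⟩ := hB.subset_ball y₀
      obtain ⟨n, hn⟩ := exists_nat_ge c
      exact ⟨n, hc.trans (Metric.ball_subset_ball hn)⟩
  tfae_have 3 → 4 := fun h => by
    rcases isEmpty_or_nonempty Y with hY | ⟨⟨y₀⟩⟩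
    · exact key (Ω := fun _ => ∅) (by simp) (by simp) monotone_const
        (fun B _ => ⟨0, hempty B⟩) fun _ => h _ isClosed_empty (by simp)
    · refine key (Ω := fun n : ℕ => Metric.closedBall y₀ n) (fun n => measurableSet_closedBall)
        (fun n => (hν _ Metric.isBounded_closedBall).ne)
        (fun m n hmn => Metric.closedBall_subset_closedBall (by exact_mod_cast hmn))
        (fun B hB => ?_) fun n => h _ Metric.isClosed_closedBall (hν _ Metric.isBounded_closedBall)
      obtain ⟨c, hc⟩ := hB.subset_closedBall y₀
      obtain ⟨n, hn⟩ := exists_nat_ge c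
      exact ⟨n, hc.trans (Metric.closedBall_subset_closedBall hn)⟩
  tfae_finish
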